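/- Let $n\ge 1$. A Jacobi matrix is a real symmetric tridiagonal $n\times n$ matrix $$\mathcal J=\begin{pmatrix} b_1&a_1& & \\ a_1&b_2&\ddots& \\ &\ddots&\ddots&a_{n-1}\\ & &a_{n-1}&b_n\end{pmatrix},\qquad b_j\in\mathbb R,\ a_j>0 .$$ For $k>0$ put $\mathcal J_{k,\times}=\mathcal J\,(I_n+ik\,e_1e_1^*)$, where $e_1=(1,0,\dots,0)^{T}$. For $z\in\mathbb C\setminus\mathbb R$ let $\operatorname{Arg}_{[0,\pi)}z=\operatorname{Arg}z$ if $\operatorname{Im}z>0$ and $\operatorname{Arg}_{[0,\pi)}z=\pi+\operatorname{Arg}z$ if $\operatorname{Im}z<0$, where $\operatorname{Arg}$ is the principal argument. All eigenvalues are counted with algebraic multiplicity, and configurations of points are unordered with repetitions allowed. Fix $k>0$. (i) If $\mathcal J$ is a Jacobi matrix with $\det\mathcal J=0$, then $0$ is an eigenvalue of $\mathcal J_{k,\times}$ of algebraic multiplicity one, and the remaining $n-1$ eigenvalues $z_1,\dots,z_{n-1}$ satisfy $$z_j\in\mathbb C\setminus\mathbb R\quad(1\le j\le n-1),\qquad \sum_{j=1}^{n-1}\operatorname{Arg}_{[0,\pi)}z_j<\arctan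 k. \tag{$*$}$$ (ii) Conversely, for each configuration $\{z_j\}_{j=1}^{n-1}$ satisfying $(*)$ there is a unique Jacobi matrix $\mathcal J$ with $\det\mathcal J=0$ such that the spectrum of $\mathcal J_{k,\times}$ is $\{0,z_1,\dots,z_{n-1}\}$. (iii) If $\mathcal J$ is a Jacobi matrix with $\det\mathcal J=0$, then the number of positive (respectively, negative) eigenvalues of $\mathcal J$ equals the number of eigenvalues of $\mathcal J_{k,\times}$ in the open upper (respectively, lower) half-plane. -/

import Mathlib

/-- A finite Jacobi matrix: a real symmetric tridiagonal matrix whose off-diagonal entries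
`J 0 1, J 1 2, …` are all positive (the diagonal is arbitrary real). -/
def IsJacobi {n : ℕ} (J : Matrix (Fin n) (Fin n) ℝ) : Prop :=
  J.IsSymm ∧
  (∀ i j : Fin n, (i : ℕ) + 1 < (j : ℕ) → J i j = 0) ∧
  (∀ i j : Fin n, (i : ℕ) + 1 = (j : ℕ) → 0 < J i j)

/-- The multiplicative rank-one perturbation `J (I + i k e₁ e₁^*)` of a square matrix of size
`m + 1`. The index `0` is the first one, and `Matrix.single 0 0 1` is `e₁ e₁^*`. -/
noncomputable def multPerturb {m : ℕ} (J : Matrix (Fin (m + 1)) (Fin (m + 1)) ℝ) (k : ℝ) :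
    Matrix (Fin (m + 1)) (Fin (m + 1)) ℂ :=
  J.map (fun x : ℝ => (x : ℂ)) * (1 + (Complex.I * (k : ℂ)) • Matrix.single 0 0 (1 : ℂ))

/-- The argument modulo `π`, with values in `[0, π)`. The principal argument is only evaluated
at non-real points, where all conventions for its value on the negative half-axis agree. -/
noncomputable def argModPi (z : ℂ) : ℝ :=
  if 0 < z.im then z.arg else if z.im = 0 then 0 else Real.pi + z.arg

/-- A configuration: `m` non-real points, with repetitions allowed and without an order, whose
arguments modulo `π` sum up to less than `arctan k`. -/
def IsConfiguration (m : ℕ) (k : ℝ) (Z : Multiset ℂ) : Prop :=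
  Z.card = m ∧ (∀ z ∈ Z, z.im ≠ 0) ∧ (Z.map argModPi).sum < Real.arctan k

/-- The eigenvalues of a square matrix over a field that lie in the field, repeated according to
their algebraic multiplicities. -/
noncomputable def eigenvalueMultiset {n : ℕ} {K : Type*} [Field K]
    (M : Matrix (Fin n) (Fin n) K) : Multiset K :=
  M.charpoly.roots

/-! Write `p` for the characteristic polynomial of `J` and `q` for that of its minor without the
first row and column. Only the first column of `J` is perturbed, so the perturbed characteristic
polynomial is `(1 + ik) p - ik X q`. If `det J = 0`, then `p = X A`, and it becomes `X R` with `R =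
A + i B`, `B = k (A - q)`. As `A` and `q` are monic of degree `m`, `deg B < m` and `R` is monic of
degree `m`. Conversely, the zeros of `R` determine `A` and `B`, hence `p` and `q`.

Pairs `(p, q)` for which `q / p` has simple real poles with positive residues correspond bijectively
to Jacobi matrices, by peeling off one step of the three-term recurrence at a time. The problem is
thus to read the positivity of the residues from the zeros of `R`.

Let `θ x` be the sum of `arg (x - z)` over the zeros `z` of `R`, with `Np` of them in the upper and
`Nm` in the lower half-plane. Along the real line `θ` runs from `(Nm - Np) π` to `0`, and `θ 0 = S -
Np π`, where `S` is the sum in the theorem. Zeros of `A` are the points where `R` is imaginary.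
Positive residues away from `0` mean that `θ` crosses odd multiples of `π / 2` upwards at positive
zeros of `A` and downwards at negative ones. Counting these crossings gives the half-plane counts
and `S < π / 2` (`IsPhase.card_roots_of_crossing`). Conversely, if `S < π / 2`, the intermediate
value theorem yields `m` distinct zeros of `A`, hence all of them, each crossed in the right
direction (`IsPhase.splits_and_crossing`). The residue at `0` then sharpens `S < π / 2` to `S <
arctan k` (`IsPhase.eval_zero_pos_iff`). -/

open Polynomial

/-! ### Interlacing pairs, partial fractions and the recurrence step. -/

/-- A pair of monic real polynomials of degrees `n + 1` and `n` with real, simple and strictly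
interlacing zeros; the last field expresses that `q / p` has positive residues. -/
structure Interlaced (n : ℕ) (p q : ℝ[X]) : Prop where
  monic_left : p.Monic
  natDegree_left : p.natDegree = n + 1
  monic_right : q.Monic
  natDegree_right : q.natDegree = n
  splits : p.Splits
  residue_pos : ∀ x, p.IsRoot x → 0 < p.derivative.eval x * q.eval x

theorem nodup_roots_of_eval_derivative_ne_zero {p : ℝ[X]} (hp : p ≠ 0)
    (h : ∀ x, p.IsRoot x → p.derivative.eval x ≠ 0) : p.roots.Nodup := by
  rw [Multiset.nodup_iff_count_le_one]
  intro x
  rw [count_roots]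
  by_contra hc
  have h2 : 1 < p.rootMultiplicity x := by omega
  obtain ⟨h3, h4⟩ := (one_lt_rootMultiplicity_iff_isRoot hp).1 h2
  exact h x h3 h4

theorem eq_nodal_of_simple_roots {p : ℝ[X]} (hp : p.Monic) (hs : p.Splits)
    (h : ∀ x, p.IsRoot x → p.derivative.eval x ≠ 0) :
    p = Lagrange.nodal p.roots.toFinset id := by
  have hn := nodup_roots_of_eval_derivative_ne_zero hp.ne_zero h
  conv_lhs => rw [hs.eq_prod_roots_of_monic hp]
  rw [Lagrange.nodal, Finset.prod, Multiset.toFinset_val, hn.dedup]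
  rfl

/-- Lagrange interpolation at the zeros of `p`: the partial fraction expansion of `q / p`, cleared
of denominators. -/
theorem eq_sum_residue_mul_nodal_erase {p q : ℝ[X]} (hp : p.Monic) (hs : p.Splits)
    (h : ∀ x, p.IsRoot x → p.derivative.eval x ≠ 0) (hq : q.degree < p.degree) :
    q = ∑ x ∈ p.roots.toFinset, C (q.eval x / p.derivative.eval x) *
      Lagrange.nodal (p.roots.toFinset.erase x) id := by
  have hnod := eq_nodal_of_simple_roots hp hs h
  set s := p.roots.toFinset with hsdef
  have hcard : p.degree = (s.card : WithBot ℕ) := by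
    rw [hnod]; exact Lagrange.degree_nodal
  refine Polynomial.eq_of_degrees_lt_of_eval_finset_eq s (hcard ▸ hq) ?_ ?_
  · refine (Polynomial.degree_sum_le _ _).trans_lt ?_
    rw [Finset.sup_lt_iff (WithBot.bot_lt_coe _)]
    intro x hx
    refine (degree_mul_le _ _).trans_lt ((add_le_add_left degree_C_le _).trans_lt ?_)
    rw [zero_add, Lagrange.degree_nodal, Finset.card_erase_of_mem hx]
    have : 0 < s.card := Finset.card_pos.2 ⟨x, hx⟩
    exact_mod_cast Nat.sub_lt this one_pos
  · intro x hx
    have hroot : p.IsRoot x := isRoot_of_mem_roots (Multiset.mem_toFinset.1 hx)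
    rw [eval_finsetSum, Finset.sum_eq_single x]
    · have hd : p.derivative.eval x = (Lagrange.nodal (s.erase x) id).eval x := by
        conv_lhs => rw [hnod]
        exact Lagrange.eval_nodal_derivative_eval_node_eq (v := id) hx
      rw [eval_mul, eval_C, ← hd, div_mul_cancel₀ _ (h x hroot)]
    · intro y _ hyx
      rw [eval_mul]
      have : (Lagrange.nodal (s.erase y) (id : ℝ → ℝ)).eval x = 0 :=
        Lagrange.eval_nodal_at_node (v := (id : ℝ → ℝ)) (Finset.mem_erase.2 ⟨hyx.symm, hx⟩)
      rw [this, mul_zero]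
    · intro hx'; exact absurd hx hx'

namespace Interlaced

variable {n : ℕ} {p q : ℝ[X]}

theorem derivative_ne_zero (h : Interlaced n p q) (x : ℝ) (hx : p.IsRoot x) :
    p.derivative.eval x ≠ 0 := left_ne_zero_of_mul (h.residue_pos x hx).ne'

theorem degree_lt (h : Interlaced n p q) : q.degree < p.degree := by
  rw [degree_eq_natDegree h.monic_left.ne_zero, degree_eq_natDegree h.monic_right.ne_zero,
    h.natDegree_left, h.natDegree_right]
  exact_mod_cast n.lt_succ_self

theorem exists_weights (h : Interlaced n p q) : ∃ (s : Finset ℝ) (w : ℝ → ℝ),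
    s.Nonempty ∧ (∀ x ∈ s, 0 < w x) ∧ p = Lagrange.nodal s id ∧
    q = ∑ x ∈ s, C (w x) * Lagrange.nodal (s.erase x) id := by
  refine ⟨p.roots.toFinset, _, ?_, ?_, eq_nodal_of_simple_roots h.monic_left h.splits
    h.derivative_ne_zero, eq_sum_residue_mul_nodal_erase h.monic_left h.splits
    h.derivative_ne_zero h.degree_lt⟩
  · rw [Multiset.toFinset_nonempty, ← Multiset.card_pos, ← h.splits.natDegree_eq_card_roots,
      h.natDegree_left]
    exact n.succ_pos
  · intro x hx
    have := h.residue_pos x (isRoot_of_mem_roots (Multiset.mem_toFinset.1 hx))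
    rw [mul_comm] at this
    exact div_pos_iff.2 (pos_and_pos_or_neg_and_neg_of_mul_pos this)

/-- By partial fractions the Wronskian is a positive combination of squares whose bases have no
common zero; equivalently, `q / p` decreases between its poles. -/
theorem wronskian_pos (h : Interlaced n p q) (x : ℝ) :
    0 < p.derivative.eval x * q.eval x - p.eval x * q.derivative.eval x := by
  obtain ⟨s, w, hs, hw, hp, hq⟩ := h.exists_weights
  have key : p.derivative * q - p * q.derivative =
      ∑ y ∈ s, C (w y) * (Lagrange.nodal (s.erase y) id) ^ 2 := by
    conv_lhs => rw [hq, derivative_sum, Finset.mul_sum, Finset.mul_sum, ← Finset.sum_sub_distrib]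
    refine Finset.sum_congr rfl fun y hy => ?_
    have hpy : p = (X - C y) * Lagrange.nodal (s.erase y) id := by
      rw [hp]; exact Lagrange.nodal_eq_mul_nodal_erase hy
    rw [hpy]
    simp only [derivative_mul, derivative_sub, derivative_X, derivative_C]
    ring
  have key' := congrArg (eval x) key
  simp only [eval_sub, eval_mul, eval_finsetSum, eval_C, eval_pow] at key'
  rw [key']
  refine Finset.sum_pos' (fun y hy => mul_nonneg (hw y hy).le (sq_nonneg _)) ?_
  have hex : ∃ y ∈ s, (Lagrange.nodal (s.erase y) (id : ℝ → ℝ)).eval x ≠ 0 := by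
    by_cases hx : x ∈ s
    · exact ⟨x, hx, Lagrange.eval_nodal_not_at_node fun i hi => (Finset.ne_of_mem_erase hi).symm⟩
    · obtain ⟨y, hy⟩ := hs
      exact ⟨y, hy, Lagrange.eval_nodal_not_at_node fun i hi hxi =>
        hx (hxi ▸ Finset.mem_of_mem_erase hi)⟩
  obtain ⟨y, hy, hne⟩ := hex
  exact ⟨y, hy, mul_pos (hw y hy) (by positivity)⟩

/-- `q / p` is a positive combination of the functions `1 / (z - y)` with `y` real, so it exchanges
the upper and lower half-planes. -/
theorem im_mul_conj (h : Interlaced n p q) {z : ℂ} (hz : z.im ≠ 0) :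
    (aeval z q * (starRingEnd ℂ) (aeval z p)).im * z.im < 0 := by
  obtain ⟨s, w, hs, hw, hp, hq⟩ := h.exists_weights
  have key : (aeval z q * (starRingEnd ℂ) (aeval z p)).im =
      ∑ y ∈ s, w y * Complex.normSq (aeval z (Lagrange.nodal (s.erase y) (id : ℝ → ℝ))) * (-z.im) := by
    conv_lhs => rw [hq, map_sum, Finset.sum_mul, Complex.im_sum]
    refine Finset.sum_congr rfl fun y hy => ?_
    have hpy : p = (X - C y) * Lagrange.nodal (s.erase y) id := by
      rw [hp]; exact Lagrange.nodal_eq_mul_nodal_erase hy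
    rw [hpy]
    simp only [map_mul, map_sub, aeval_X, aeval_C, Complex.coe_algebraMap, Complex.conj_ofReal]
    rw [Complex.normSq_apply]
    simp only [Complex.mul_im, Complex.mul_re, Complex.sub_re, Complex.sub_im, Complex.ofReal_re,
      Complex.ofReal_im, Complex.conj_re, Complex.conj_im]
    ring
  rw [key, Finset.sum_mul, ← neg_pos, ← Finset.sum_neg_distrib]
  refine Finset.sum_pos (fun y hy => ?_) hs
  have h1 : aeval z (Lagrange.nodal (s.erase y) (id : ℝ → ℝ)) ≠ 0 := by
    rw [Lagrange.nodal, map_prod, Finset.prod_ne_zero_iff]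
    intro a _ h0
    apply hz
    have := congrArg Complex.im h0
    simpa using this
  have h2 := Complex.normSq_pos.2 h1
  have h3 : 0 < z.im ^ 2 := by positivity
  have := mul_pos (mul_pos (hw y hy) h2) h3
  nlinarith

end Interlaced

theorem splits_of_forall_aeval_ne_zero {q : ℝ[X]} (h : ∀ z : ℂ, z.im ≠ 0 → aeval z q ≠ 0) :
    q.Splits := by
  refine Splits.of_splits_map (algebraMap ℝ ℂ) (IsAlgClosed.splits _) fun a ha => ?_
  have ha' := isRoot_of_mem_roots ha
  rw [IsRoot, eval_map_algebraMap] at ha'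
  refine ⟨a.re, ?_⟩
  have : a.im = 0 := by
    by_contra hne
    exact h a hne ha'
  exact Complex.ext (by simp) (by simp [this])

namespace Interlaced

variable {n : ℕ} {p q r : ℝ[X]}

theorem splits_right (h : Interlaced n p q) : q.Splits :=
  splits_of_forall_aeval_ne_zero fun z hz h0 => by
    have := h.im_mul_conj hz
    rw [h0] at this
    simp at this

/-- At a non-real zero of `p`, `r / q` would equal `(z - b) / a ^ 2`, whose imaginary part has the
wrong sign. At a real zero the residue condition reduces to positivity of the Wronskian of `q` and
`r`. -/
theorem up (h : Interlaced n q r) {a : ℝ} (b : ℝ) (ha : 0 < a)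
    (hp : p = (X - C b) * q - C (a ^ 2) * r) : Interlaced (n + 1) p q := by
  have hdeg : (C (a ^ 2) * r).degree < ((X - C b) * q).degree := by
    rw [degree_C_mul (pow_pos ha 2).ne']
    refine h.degree_lt.trans_le ?_
    rw [degree_mul, degree_X_sub_C]
    exact le_add_of_nonneg_left zero_le_one
  have hm : ((X - C b) * q).Monic := (monic_X_sub_C b).mul h.monic_left
  have ha2 : 0 < a ^ 2 := by positivity
  refine ⟨hp ▸ hm.sub_of_left hdeg, ?_, h.monic_left, h.natDegree_left, ?_, ?_⟩
  · have : p.natDegree = ((X - C b) * q).natDegree := by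
      rw [hp]; exact natDegree_eq_of_degree_eq (degree_sub_eq_left_of_degree_lt hdeg)
    rw [this, (monic_X_sub_C b).natDegree_mul h.monic_left, natDegree_X_sub_C, h.natDegree_left]
    ring
  · refine splits_of_forall_aeval_ne_zero fun z hz h0 => ?_
    have h1 := h.im_mul_conj hz
    have h2 : aeval z p = (z - b) * aeval z q - (a : ℂ) ^ 2 * aeval z r := by
      rw [hp]; simp
    rw [h0] at h2
    have h3 : (a ^ 2 : ℝ) * (aeval z r * (starRingEnd ℂ) (aeval z q)).im =
        z.im * Complex.normSq (aeval z q) := by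
      have h4 : ((a ^ 2 : ℝ) : ℂ) * (aeval z r * (starRingEnd ℂ) (aeval z q)) =
          (z - b) * ((Complex.normSq (aeval z q) : ℝ) : ℂ) := by
        rw [← Complex.mul_conj]
        push_cast
        linear_combination (starRingEnd ℂ) (aeval z q) * h2
      have := congrArg Complex.im h4
      rw [Complex.im_ofReal_mul, Complex.im_mul_ofReal] at this
      simpa using this
    have h5 : (a ^ 2 : ℝ) * ((aeval z r * (starRingEnd ℂ) (aeval z q)).im * z.im) =
        z.im ^ 2 * Complex.normSq (aeval z q) := by
      rw [← mul_assoc, h3]; ring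
    have h6 := mul_neg_of_pos_of_neg ha2 h1
    rw [h5] at h6
    exact absurd h6 (not_lt.2 (mul_nonneg (sq_nonneg _) (Complex.normSq_nonneg _)))
  · intro x hx
    have hW := h.wronskian_pos x
    have h1 : p.derivative.eval x = q.eval x + (x - b) * q.derivative.eval x
        - a ^ 2 * r.derivative.eval x := by
      rw [hp, derivative_sub, derivative_C_mul, derivative_mul]; simp
    have h2 : (x - b) * q.eval x - a ^ 2 * r.eval x = 0 := by
      have := hx
      rw [IsRoot, hp] at this
      simpa using this
    have h3 : p.derivative.eval x * q.eval x = q.eval x ^ 2 + a ^ 2 *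
        (q.derivative.eval x * r.eval x - q.eval x * r.derivative.eval x) := by
      rw [h1]; linear_combination q.derivative.eval x * h2
    rw [h3]
    have := mul_pos ha2 hW
    positivity

/-- Divide `p` by `q`: the quotient is `X - b` and the remainder is `-s`. At zeros of `q` the
Wronskian makes `p q'` negative, so `s / q` has positive residues. Their sum is the coefficient of
`s` in degree `n`; it supplies `a ^ 2`. -/
theorem down (h : Interlaced (n + 1) p q) : ∃ (a b : ℝ) (r : ℝ[X]), 0 < a ∧
    p = (X - C b) * q - C (a ^ 2) * r ∧ Interlaced n q r := by
  have hqs := h.splits_right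
  have hroot : ∀ x, q.IsRoot x → p.eval x * q.derivative.eval x < 0 := fun x hx => by
    have := h.wronskian_pos x
    rw [IsRoot] at hx
    rw [hx] at this
    linarith
  have hqd : ∀ x, q.IsRoot x → q.derivative.eval x ≠ 0 := fun x hx =>
    right_ne_zero_of_mul (hroot x hx).ne
  have hqm := h.monic_right
  have hqn := h.natDegree_right
  obtain ⟨b, hb⟩ : ∃ b : ℝ, ((X - C b) * q - p).degree < q.degree := by
    -- This value cancels the coefficient in degree `n + 1`; the one in degree `n + 2` cancels since
    -- both polynomials are monic.
    refine ⟨q.coeff n - p.coeff (n + 1), ?_⟩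
    rw [degree_eq_natDegree hqm.ne_zero, hqn, degree_lt_iff_coeff_zero]
    intro j hj
    have hj' : n + 1 ≤ j := by exact_mod_cast hj
    obtain ⟨j, rfl⟩ : ∃ i, j = i + 1 := ⟨j - 1, by omega⟩
    rw [coeff_sub, sub_mul, coeff_sub, coeff_X_mul, coeff_C_mul]
    have h1 : q.coeff (n + 1) = 1 := by rw [← hqn]; exact hqm.coeff_natDegree
    have h2 : p.coeff (n + 2) = 1 := by
      have := h.monic_left.coeff_natDegree
      rwa [h.natDegree_left] at this
    rcases lt_trichotomy j (n + 1) with hlt | heq | hgt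
    · obtain rfl : j = n := by omega
      rw [h1]; ring
    · subst heq
      have h3 : q.coeff (n + 1 + 1) = 0 := coeff_eq_zero_of_natDegree_lt (by omega)
      rw [h1, h3, h2]; ring
    · have h3 : q.coeff j = 0 := coeff_eq_zero_of_natDegree_lt (by omega)
      have h4 : q.coeff (j + 1) = 0 := coeff_eq_zero_of_natDegree_lt (by omega)
      have h5 : p.coeff (j + 1) = 0 :=
        coeff_eq_zero_of_natDegree_lt (by rw [h.natDegree_left]; omega)
      rw [h3, h4, h5]; ring
  set s : ℝ[X] := (X - C b) * q - p with hsdef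
  have hspos : ∀ x, q.IsRoot x → 0 < q.derivative.eval x * s.eval x := fun x hx => by
    have := hroot x hx
    have h0 : q.eval x = 0 := hx
    have : s.eval x = - p.eval x := by rw [hsdef]; simp [h0]
    rw [this]; linarith
  have hnod := eq_nodal_of_simple_roots hqm hqs hqd
  have hsum := eq_sum_residue_mul_nodal_erase hqm hqs hqd hb
  have hcard : q.roots.toFinset.card = n + 1 := by
    rw [← hqn]; conv_rhs => rw [hnod]
    exact Lagrange.natDegree_nodal.symm
  have hcoeff : 0 < s.coeff n := by
    rw [hsum, finsetSum_coeff]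
    refine Finset.sum_pos (fun x hx => ?_) (Finset.card_pos.1 (by omega))
    have h1 : (Lagrange.nodal (q.roots.toFinset.erase x) (id : ℝ → ℝ)).coeff n = 1 := by
      have h2 : (Lagrange.nodal (q.roots.toFinset.erase x) (id : ℝ → ℝ)).natDegree = n := by
        rw [Lagrange.natDegree_nodal, Finset.card_erase_of_mem hx, hcard, Nat.add_sub_cancel]
      have h3 := (Lagrange.nodal_monic (s := q.roots.toFinset.erase x)
        (v := (id : ℝ → ℝ))).coeff_natDegree
      rwa [h2] at h3
    rw [coeff_C_mul, h1, mul_one]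
    have := hspos x (isRoot_of_mem_roots (Multiset.mem_toFinset.1 hx))
    rw [mul_comm] at this
    exact div_pos_iff.2 (pos_and_pos_or_neg_and_neg_of_mul_pos this)
  have hsn : s.natDegree = n := by
    refine le_antisymm ?_ (le_natDegree_of_ne_zero hcoeff.ne')
    have := natDegree_lt_natDegree (fun h0 => by simp [h0] at hcoeff) hb
    omega
  have hinv : (s.coeff n)⁻¹ ≠ 0 := (inv_pos.2 hcoeff).ne'
  refine ⟨√(s.coeff n), b, C (s.coeff n)⁻¹ * s, Real.sqrt_pos.2 hcoeff, ?_, hqm, hqn, ?_, ?_, hqs,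
    fun x hx => ?_⟩
  · rw [Real.sq_sqrt hcoeff.le, ← mul_assoc, ← C_mul, mul_inv_cancel₀ hcoeff.ne', C_1, one_mul,
      hsdef]
    ring
  · rw [Monic, leadingCoeff_mul, leadingCoeff_C, leadingCoeff, hsn, inv_mul_cancel₀ hcoeff.ne']
  · rw [natDegree_C_mul hinv, hsn]
  · rw [eval_mul, eval_C]
    have := mul_pos (inv_pos.2 hcoeff) (hspos x hx)
    linarith

end Interlaced

theorem interlaced_zero_iff {p q : ℝ[X]} : Interlaced 0 p q ↔ (∃ b, p = X - C b) ∧ q = 1 := by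
  constructor
  · intro h
    refine ⟨⟨-p.coeff 0, ?_⟩, ?_⟩
    · have := h.monic_left.eq_X_add_C h.natDegree_left
      rw [this]; simp
    · exact h.monic_right.natDegree_eq_zero.1 h.natDegree_right
  · rintro ⟨⟨b, rfl⟩, rfl⟩
    exact ⟨monic_X_sub_C b, natDegree_X_sub_C b, monic_one, natDegree_one, Splits.X_sub_C b,
      fun x _ => by simp⟩

/-- The coefficients of the three-term recurrence are determined by the polynomials. -/
theorem recurrence_unique {n : ℕ} {q r r' : ℝ[X]} {a a' b b' : ℝ} (h : Interlaced n q r)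
    (h' : Interlaced n q r') (ha : 0 < a) (ha' : 0 < a')
    (heq : (X - C b) * q - C (a ^ 2) * r = (X - C b') * q - C (a' ^ 2) * r') :
    a = a' ∧ b = b' ∧ r = r' := by
  have h1 : C (b' - b) * q = C (a ^ 2) * r - C (a' ^ 2) * r' := by
    rw [C_sub]; linear_combination heq
  have hb : b = b' := by
    have hc := congrArg (fun f => f.coeff (n + 1)) h1
    have hq : q.coeff (n + 1) = 1 := by rw [← h.natDegree_left]; exact h.monic_left.coeff_natDegree
    have hr : r.coeff (n + 1) = 0 :=
      coeff_eq_zero_of_natDegree_lt (by rw [h.natDegree_right]; omega)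
    have hr' : r'.coeff (n + 1) = 0 :=
      coeff_eq_zero_of_natDegree_lt (by rw [h'.natDegree_right]; omega)
    simp only [coeff_sub, coeff_C_mul, hq, hr, hr'] at hc
    linarith
  subst hb
  have h2 : C (a ^ 2) * r = C (a' ^ 2) * r' := by
    simp only [sub_self, C_0, zero_mul] at h1
    linear_combination -h1
  have ha2 : a ^ 2 = a' ^ 2 := by
    have := congrArg leadingCoeff h2
    simpa [leadingCoeff_mul, h.monic_right.leadingCoeff, h'.monic_right.leadingCoeff] using this
  refine ⟨(sq_eq_sq₀ ha.le ha'.le).1 ha2, rfl, ?_⟩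
  rw [← ha2] at h2
  exact mul_left_cancel₀ (C_ne_zero.2 (by positivity)) h2

/-! ### Jacobi matrices and interlacing pairs. -/

theorem det_eq_of_border_eq_zero {R : Type*} [CommRing R] {n : ℕ}
    (M : Matrix (Fin (n + 2)) (Fin (n + 2)) R) (hr : ∀ j : Fin n, M 0 j.succ.succ = 0)
    (hc : ∀ i : Fin n, M i.succ.succ 0 = 0) :
    M.det = M 0 0 * (M.submatrix Fin.succ Fin.succ).det - M 0 1 * M 1 0 *
      ((M.submatrix Fin.succ Fin.succ).submatrix Fin.succ Fin.succ).det := by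
  rw [Matrix.det_succ_row_zero, Fin.sum_univ_succ, Fin.sum_univ_succ]
  have h1 : (M.submatrix Fin.succ (Fin.succAbove (Fin.succ 0))).det =
      M 1 0 * ((M.submatrix Fin.succ Fin.succ).submatrix Fin.succ Fin.succ).det := by
    rw [Matrix.det_succ_column_zero, Fin.sum_univ_succ, Finset.sum_eq_zero]
    · simp only [Matrix.submatrix_submatrix, Matrix.submatrix_apply]
      simp [Function.comp_def]
    · intro i _
      simp [hc]
  rw [h1, Finset.sum_eq_zero]
  · simp
    ring
  · intro i _
    simp [hr]

theorem charmatrix_submatrix_succ {R : Type*} [CommRing R] {n : ℕ}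
    (M : Matrix (Fin (n + 1)) (Fin (n + 1)) R) :
    Matrix.charmatrix (M.submatrix Fin.succ Fin.succ) =
      (Matrix.charmatrix M).submatrix Fin.succ Fin.succ := by
  ext1 i j
  simp [Matrix.charmatrix_apply, Matrix.diagonal_apply]

/-- The characteristic polynomial of the matrix without its first row and column. -/
noncomputable def minorCharpoly {R : Type*} [CommRing R] {n : ℕ}
    (M : Matrix (Fin (n + 1)) (Fin (n + 1)) R) : R[X] :=
  (M.submatrix Fin.succ Fin.succ).charpoly

namespace IsJacobi

variable {n : ℕ}

theorem submatrix_succ {J : Matrix (Fin (n + 1)) (Fin (n + 1)) ℝ} (h : IsJacobi J) :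
    IsJacobi (J.submatrix Fin.succ Fin.succ) := by
  refine ⟨h.1.submatrix _, fun i j hij => h.2.1 _ _ ?_, fun i j hij => h.2.2 _ _ ?_⟩
  · simp only [Fin.val_succ]; omega
  · simp only [Fin.val_succ]; omega

theorem zero_one_pos {J : Matrix (Fin (n + 2)) (Fin (n + 2)) ℝ} (h : IsJacobi J) : 0 < J 0 1 :=
  h.2.2 0 1 (by simp)

theorem zero_succ_succ {J : Matrix (Fin (n + 2)) (Fin (n + 2)) ℝ} (h : IsJacobi J) (j : Fin n) :
    J 0 j.succ.succ = 0 := h.2.1 _ _ (by simp)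

theorem symm_apply {J : Matrix (Fin n) (Fin n) ℝ} (h : IsJacobi J) (i j : Fin n) :
    J i j = J j i := h.1.apply j i

theorem charpoly_eq {J : Matrix (Fin (n + 2)) (Fin (n + 2)) ℝ} (h : IsJacobi J) :
    J.charpoly = (X - C (J 0 0)) * minorCharpoly J -
      C (J 0 1 ^ 2) * minorCharpoly (J.submatrix Fin.succ Fin.succ) := by
  have h10 : J 1 0 = J 0 1 := h.symm_apply 1 0
  rw [Matrix.charpoly, det_eq_of_border_eq_zero, minorCharpoly, minorCharpoly, Matrix.charpoly,
    Matrix.charpoly, charmatrix_submatrix_succ, charmatrix_submatrix_succ,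
    charmatrix_submatrix_succ, Matrix.charmatrix_apply_eq,
    Matrix.charmatrix_apply_ne _ _ _ Fin.zero_ne_one,
    Matrix.charmatrix_apply_ne _ _ _ Fin.zero_ne_one.symm, h10, C_pow]
  · ring
  · intro j
    rw [Matrix.charmatrix_apply_ne _ _ _ (Fin.succ_ne_zero _).symm, h.zero_succ_succ, C_0, neg_zero]
  · intro j
    rw [Matrix.charmatrix_apply_ne _ _ _ (Fin.succ_ne_zero _), h.symm_apply, h.zero_succ_succ, C_0,
      neg_zero]

theorem interlaced : ∀ {n : ℕ} {J : Matrix (Fin (n + 1)) (Fin (n + 1)) ℝ}, IsJacobi J →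
    Interlaced n J.charpoly (minorCharpoly J)
  | 0, J, _ => by
    rw [interlaced_zero_iff]
    refine ⟨⟨J 0 0, ?_⟩, ?_⟩
    · rw [Matrix.charpoly, Matrix.det_fin_one, Matrix.charmatrix_apply_eq]
    · rw [minorCharpoly, Matrix.charpoly, Matrix.det_fin_zero]
  | n + 1, J, h => h.submatrix_succ.interlaced.up _ h.zero_one_pos h.charpoly_eq

/-- A Jacobi matrix is determined by its characteristic polynomial and that of its minor. -/
theorem eq_of_charpoly_eq : ∀ {n : ℕ} {J J' : Matrix (Fin (n + 1)) (Fin (n + 1)) ℝ},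
    IsJacobi J → IsJacobi J' → J.charpoly = J'.charpoly → minorCharpoly J = minorCharpoly J' →
    J = J'
  | 0, J, J', _, _, hp, _ => by
    have h1 : ∀ A : Matrix (Fin 1) (Fin 1) ℝ, A.charpoly = X - C (A 0 0) := fun A => by
      rw [Matrix.charpoly, Matrix.det_fin_one, Matrix.charmatrix_apply_eq]
    rw [h1, h1, sub_right_inj] at hp
    ext i j
    obtain rfl : i = 0 := Fin.ext (by omega)
    obtain rfl : j = 0 := Fin.ext (by omega)
    exact C_injective hp
  | n + 1, J, J', h, h', hp, hq => by
    have e := h.charpoly_eq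
    have e' := h'.charpoly_eq
    have i1 := h.submatrix_succ.interlaced
    have i2 := h'.submatrix_succ.interlaced
    rw [← minorCharpoly] at i1 i2
    rw [hp, e', hq] at e
    rw [hq] at i1
    obtain ⟨ha, hb, hr⟩ := recurrence_unique i2 i1 h'.zero_one_pos h.zero_one_pos e
    have ih := eq_of_charpoly_eq h.submatrix_succ h'.submatrix_succ hq hr.symm
    have hss : ∀ i j : Fin (n + 1), J i.succ j.succ = J' i.succ j.succ := fun i j =>
      congrFun (congrFun ih i) j
    have h0 : ∀ j : Fin (n + 2), J 0 j = J' 0 j := fun j => by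
      refine Fin.cases hb.symm (fun j => ?_) j
      refine Fin.cases ha.symm (fun j => ?_) j
      rw [h.zero_succ_succ, h'.zero_succ_succ]
    ext i j
    refine Fin.cases (h0 j) (fun i => ?_) i
    refine Fin.cases ?_ (fun j => hss i j) j
    rw [h.symm_apply, h'.symm_apply, h0]

/-- Adjoin a first row and column to a tridiagonal matrix. -/
def extend (a b : ℝ) (J : Matrix (Fin (n + 1)) (Fin (n + 1)) ℝ) :
    Matrix (Fin (n + 2)) (Fin (n + 2)) ℝ :=
  Matrix.of (Fin.cons (Fin.cons b (Fin.cons a 0))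
    (fun i => Fin.cons ((Fin.cons a 0 : Fin (n + 1) → ℝ) i) (J i)))

theorem extend_isJacobi {a : ℝ} (b : ℝ) (ha : 0 < a) {J : Matrix (Fin (n + 1)) (Fin (n + 1)) ℝ}
    (h : IsJacobi J) : IsJacobi (extend a b J) := by
  refine ⟨?_, ?_, ?_⟩
  · refine Matrix.IsSymm.ext fun i j => ?_
    refine Fin.cases ?_ (fun i => ?_) i <;> refine Fin.cases ?_ (fun j => ?_) j
    · rfl
    · rfl
    · rfl
    · exact h.1.apply i j
  · intro i j
    refine Fin.cases ?_ (fun i => ?_) i <;> refine Fin.cases ?_ (fun j => ?_) j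
    · intro hij; simp at hij
    · refine Fin.cases ?_ (fun j => ?_) j
      · intro hij; simp at hij
      · intro _; rfl
    · intro hij; simp at hij
    · intro hij
      exact h.2.1 i j (by simpa using hij)
  · intro i j
    refine Fin.cases ?_ (fun i => ?_) i <;> refine Fin.cases ?_ (fun j => ?_) j
    · intro hij; simp at hij
    · refine Fin.cases ?_ (fun j => ?_) j
      · intro _; exact ha
      · intro hij; simp at hij
    · intro hij; simp at hij
    · intro hij
      exact h.2.2 i j (by simpa using hij)

theorem exists_of_interlaced : ∀ {n : ℕ} {p q : ℝ[X]}, Interlaced n p q →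
    ∃ J : Matrix (Fin (n + 1)) (Fin (n + 1)) ℝ, IsJacobi J ∧ J.charpoly = p ∧ minorCharpoly J = q
  | 0, p, q, h => by
    obtain ⟨⟨b, rfl⟩, rfl⟩ := interlaced_zero_iff.1 h
    refine ⟨Matrix.of fun _ _ => b, ⟨rfl, ?_, ?_⟩, ?_, ?_⟩
    · intro i j hij; omega
    · intro i j hij; omega
    · rw [Matrix.charpoly, Matrix.det_fin_one, Matrix.charmatrix_apply_eq]; rfl
    · rw [minorCharpoly, Matrix.charpoly, Matrix.det_fin_zero]
  | n + 1, p, q, h => by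
    obtain ⟨a, b, r, ha, hp, hqr⟩ := h.down
    obtain ⟨J, hJ, rfl, rfl⟩ := exists_of_interlaced hqr
    have hJ' := extend_isJacobi b ha hJ
    refine ⟨_, hJ', ?_, rfl⟩
    rw [hJ'.charpoly_eq, hp]
    rfl

end IsJacobi

/-! ### Characteristic polynomial of the perturbation. -/

theorem charpoly_multPerturb {m : ℕ} (J : Matrix (Fin (m + 1)) (Fin (m + 1)) ℝ) (k : ℝ) :
    (multPerturb J k).charpoly = C (1 + Complex.I * k) * J.charpoly.map (algebraMap ℝ ℂ) -
      C (Complex.I * k) * (X * (minorCharpoly J).map (algebraMap ℝ ℂ)) := by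
  set A : Matrix (Fin (m + 1)) (Fin (m + 1)) ℂ := J.map (algebraMap ℝ ℂ) with hA
  have hent : ∀ i j, multPerturb J k i j =
      if j = 0 then (1 + Complex.I * k) * A i j else A i j := by
    intro i j
    have : multPerturb J k = A + (Complex.I * (k : ℂ)) • (A * Matrix.single 0 0 1) := by
      rw [multPerturb, mul_add, mul_one, Matrix.mul_smul]; rfl
    rw [this, Matrix.add_apply, Matrix.smul_apply]
    by_cases hj : j = 0
    · subst hj
      rw [Matrix.mul_single_apply_same]
      simp
      ring
    · rw [Matrix.mul_single_apply_of_ne _ _ _ _ _ hj]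
      simp [hj]
  -- With `c = 1 + ik`, the first column is `X e₁ - c A e₁ = c (X e₁ - A e₁) - ik X e₁`; linearity
  -- of the determinant in this column gives the formula.
  have hcol : (multPerturb J k).charmatrix = A.charmatrix.updateCol 0
      (C (1 + Complex.I * (k : ℂ)) • (fun i => A.charmatrix i 0) +
        (-(C (Complex.I * (k : ℂ)) * X)) • Pi.single 0 1) := by
    ext1 i j
    rw [Matrix.updateCol_apply]
    by_cases hj : j = 0
    · subst hj
      rw [if_pos rfl]
      by_cases hi : i = 0
      · subst hi
        rw [Matrix.charmatrix_apply_eq, hent]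
        simp [Matrix.charmatrix_apply_eq]
        ring
      · rw [Matrix.charmatrix_apply_ne _ _ _ hi, hent]
        simp [hi]
    · rw [if_neg hj, Matrix.charmatrix_apply, Matrix.charmatrix_apply, hent, if_neg hj]
  have hunit : (A.charmatrix.updateCol 0 (Pi.single 0 1)).det =
      (A.submatrix Fin.succ Fin.succ).charpoly := by
    rw [Matrix.det_succ_column_zero, Fin.sum_univ_succ, Finset.sum_eq_zero, Matrix.charpoly,
      charmatrix_submatrix_succ]
    · simp only [Matrix.updateCol_self, Pi.single_eq_same]
      simp
      congr 1
    · intro i _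
      simp
  rw [Matrix.charpoly, hcol, Matrix.det_updateCol_add, Matrix.det_updateCol_smul,
    Matrix.det_updateCol_smul, Matrix.updateCol_eq_self, hunit, ← Matrix.charpoly, hA,
    Matrix.charpoly_map, minorCharpoly, show (J.map (algebraMap ℝ ℂ)).submatrix Fin.succ Fin.succ =
    (J.submatrix Fin.succ Fin.succ).map (algebraMap ℝ ℂ) from rfl, Matrix.charpoly_map]
  ring

/-! ### The phase on the real line and its direction at zeros of the real part. -/

/-- The continuous phase on the real line of the polynomial with the zeros `Z`. -/
noncomputable def zerosPhase (Z : Multiset ℂ) (x : ℝ) : ℝ :=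
  (Z.map fun z => Complex.arg (x - z)).sum

section Phase

open Filter Topology Real

theorem zerosPhase_cons (z : ℂ) (Z : Multiset ℂ) (x : ℝ) :
    zerosPhase (z ::ₘ Z) x = Complex.arg (x - z) + zerosPhase Z x := by
  rw [zerosPhase, Multiset.map_cons, Multiset.sum_cons, zerosPhase]

/-- For non-real `z` the point `x - z` never meets the branch cut of `arg`, so no unwrapping is
needed. -/
theorem continuous_zerosPhase {Z : Multiset ℂ} (hZ : ∀ z ∈ Z, z.im ≠ 0) :
    Continuous (zerosPhase Z) := by
  refine continuous_multiset_sum (f := fun (z : ℂ) (x : ℝ) => Complex.arg (x - z)) Z fun z hz => ?_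
  refine continuous_iff_continuousAt.2 fun x => ?_
  refine ContinuousAt.comp (g := Complex.arg) (Complex.continuousAt_arg ?_) (by fun_prop)
  right
  simpa using hZ z hz

theorem exists_polar_zerosPhase {Z : Multiset ℂ} (hZ : ∀ z ∈ Z, z.im ≠ 0) (x : ℝ) :
    ∃ ρ : ℝ, 0 < ρ ∧ (Z.map fun z => (x : ℂ) - z).prod = ρ * Complex.exp (zerosPhase Z x * Complex.I) := by
  induction Z using Multiset.induction with
  | empty => exact ⟨1, one_pos, by simp [zerosPhase]⟩
  | cons z Z ih =>
    obtain ⟨ρ, hρ, h⟩ := ih fun w hw => hZ w (Multiset.mem_cons_of_mem hw)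
    refine ⟨‖(x : ℂ) - z‖ * ρ, mul_pos (norm_pos_iff.2 fun h0 => ?_) hρ, ?_⟩
    · apply hZ z (Multiset.mem_cons_self z Z)
      simpa using congrArg Complex.im h0
    · rw [Multiset.map_cons, Multiset.prod_cons, h, zerosPhase_cons]
      conv_lhs => rw [← Complex.norm_mul_exp_arg_mul_I ((x : ℂ) - z)]
      push_cast
      rw [add_mul, Complex.exp_add]
      ring

theorem tendsto_arg_sub_atTop (z : ℂ) :
    Tendsto (fun x : ℝ => Complex.arg (x - z)) atTop (𝓝 0) := by
  have h1 : Tendsto (fun x : ℝ => (1 : ℂ) - (x⁻¹ : ℝ) * z) atTop (𝓝 1) := by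
    have h0 : Tendsto (fun x : ℝ => ((x⁻¹ : ℝ) : ℂ)) atTop (𝓝 ((0 : ℝ) : ℂ)) :=
      (Complex.continuous_ofReal.tendsto 0).comp tendsto_inv_atTop_zero
    have := (tendsto_const_nhds (x := (1 : ℂ))).sub (h0.mul_const z)
    simpa using this
  have h2 := (Complex.continuousAt_arg Complex.one_mem_slitPlane).tendsto.comp h1
  rw [Complex.arg_one] at h2
  refine h2.congr' ?_
  filter_upwards [eventually_gt_atTop 0] with x hx
  -- Dividing by the positive number `x` leaves the argument unchanged and moves the point towards
  -- `1`.
  have : (x : ℂ) - z = (x : ℝ) * (1 - (x⁻¹ : ℝ) * z) := by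
    have : (x : ℂ) ≠ 0 := by exact_mod_cast hx.ne'
    push_cast
    field_simp
  rw [this, Complex.arg_real_mul _ hx]
  rfl

theorem tendsto_zerosPhase_atTop (Z : Multiset ℂ) : Tendsto (zerosPhase Z) atTop (𝓝 0) := by
  have := tendsto_multiset_sum (f := fun (z : ℂ) (x : ℝ) => Complex.arg (x - z))
    (a := fun _ => 0) (x := atTop) Z fun z _ => tendsto_arg_sub_atTop z
  simp only [Multiset.map_const', Multiset.sum_replicate, smul_zero] at this
  exact this

theorem tendsto_arg_sub_atBot {z : ℂ} (hz : z.im ≠ 0) :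
    Tendsto (fun x : ℝ => Complex.arg (x - z)) atBot (𝓝 (if 0 < z.im then -π else π)) := by
  have h1 := (tendsto_arg_sub_atTop (-z)).comp tendsto_neg_atBot_atTop
  have h2 : ∀ x : ℝ, Complex.arg (x - z) =
      Complex.arg ((-x : ℝ) - (-z)) + if 0 < z.im then -π else π := fun x => by
    have e : (x : ℂ) - z = -((-x : ℝ) - (-z)) := by push_cast; ring
    rw [e]
    split_ifs with h
    · rw [Complex.arg_neg_eq_arg_sub_pi_of_im_pos (by simpa using h), sub_eq_add_neg]
    · rw [Complex.arg_neg_eq_arg_add_pi_of_im_neg]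
      simpa using lt_of_le_of_ne (not_lt.1 h) hz
  have h3 := h1.add_const (if 0 < z.im then -π else π)
  rw [zero_add] at h3
  exact h3.congr fun x => (h2 x).symm

theorem card_eq_countP_im_add {Z : Multiset ℂ} (hZ : ∀ z ∈ Z, z.im ≠ 0) :
    Z.card = Z.countP (fun z => 0 < z.im) + Z.countP (fun z => z.im < 0) := by
  rw [Multiset.card_eq_countP_add_countP (fun z : ℂ => 0 < z.im) Z]
  congr 1
  exact Multiset.countP_congr rfl fun z hz => propext
    ⟨fun h => lt_of_le_of_ne (not_lt.1 h) (hZ z hz), fun h => not_lt.2 h.le⟩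

theorem tendsto_zerosPhase_atBot {Z : Multiset ℂ} (hZ : ∀ z ∈ Z, z.im ≠ 0) :
    Tendsto (zerosPhase Z) atBot (𝓝 (((Z.countP fun z => z.im < 0 : ℕ) -
      (Z.countP fun z => 0 < z.im : ℕ)) * π)) := by
  have := tendsto_multiset_sum (f := fun (z : ℂ) (x : ℝ) => Complex.arg (x - z))
    (a := fun z => if 0 < z.im then -π else π) (x := atBot) Z
    fun z hz => tendsto_arg_sub_atBot (hZ z hz)
  refine this.trans_eq ?_
  congr 1
  clear this
  induction Z using Multiset.induction with
  | empty => simp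
  | cons z Z ih =>
    rw [Multiset.map_cons, Multiset.sum_cons, ih fun w hw => hZ w (Multiset.mem_cons_of_mem hw),
      Multiset.countP_cons, Multiset.countP_cons]
    rcases lt_or_gt_of_ne (hZ z (Multiset.mem_cons_self z Z)) with h | h
    · simp [h, h.not_gt]; ring
    · simp [h, h.not_gt]; ring

theorem zerosPhase_zero {Z : Multiset ℂ} (hZ : ∀ z ∈ Z, z.im ≠ 0) :
    zerosPhase Z 0 = (Z.map argModPi).sum - (Z.countP fun z => 0 < z.im : ℕ) * π := by
  induction Z using Multiset.induction with
  | empty => simp [zerosPhase]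
  | cons z Z ih =>
    rw [zerosPhase_cons,
      ih fun w hw => hZ w (Multiset.mem_cons_of_mem hw), Multiset.map_cons, Multiset.sum_cons,
      Multiset.countP_cons, argModPi, Complex.ofReal_zero, zero_sub]
    rcases lt_or_gt_of_ne (hZ z (Multiset.mem_cons_self z Z)) with h | h
    · rw [Complex.arg_neg_eq_arg_add_pi_of_im_neg h, if_neg h.not_gt, if_neg h.ne, if_neg h.not_gt]
      push_cast; ring
    · rw [Complex.arg_neg_eq_arg_sub_pi_of_im_pos h, if_pos h, if_pos h]
      push_cast; ring

theorem argModPi_nonneg (z : ℂ) : 0 ≤ argModPi z := by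
  rw [argModPi]
  split_ifs with h1 h2
  · exact Complex.arg_nonneg_iff.2 h1.le
  · exact le_rfl
  · linarith [Complex.neg_pi_lt_arg z]

/-- `θ` is a continuous phase of the complex polynomial `A + i B` on the real line. -/
structure IsPhase (θ : ℝ → ℝ) (A B : ℝ[X]) : Prop where
  continuous : Continuous θ
  polar : ∀ x, ∃ ρ : ℝ, 0 < ρ ∧ A.eval x = ρ * cos (θ x) ∧ B.eval x = ρ * sin (θ x)

theorem isPhase_zerosPhase {Z : Multiset ℂ} (hZ : ∀ z ∈ Z, z.im ≠ 0) {A B : ℝ[X]}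
    (h : ∀ x : ℝ, (Z.map fun z => (x : ℂ) - z).prod = (A.eval x : ℝ) + (B.eval x : ℝ) * Complex.I) :
    IsPhase (zerosPhase Z) A B := by
  refine ⟨continuous_zerosPhase hZ, fun x => ?_⟩
  obtain ⟨ρ, hρ, h1⟩ := exists_polar_zerosPhase hZ x
  rw [h, Complex.exp_mul_I, ← Complex.ofReal_cos, ← Complex.ofReal_sin] at h1
  refine ⟨ρ, hρ, ?_, ?_⟩
  · simpa [-Complex.ofReal_cos, -Complex.ofReal_sin] using congrArg Complex.re h1
  · simpa [-Complex.ofReal_cos, -Complex.ofReal_sin] using congrArg Complex.im h1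

namespace IsPhase

variable {θ : ℝ → ℝ} {A B : ℝ[X]}

theorem cos_eq_zero_iff (h : IsPhase θ A B) (x : ℝ) : cos (θ x) = 0 ↔ A.IsRoot x := by
  obtain ⟨ρ, hρ, h1, -⟩ := h.polar x
  rw [IsRoot, h1, mul_eq_zero, or_iff_right hρ.ne']

theorem eval_right_ne_zero (h : IsPhase θ A B) {x : ℝ} (hx : A.IsRoot x) : B.eval x ≠ 0 := by
  obtain ⟨ρ, hρ, -, h2⟩ := h.polar x
  rw [h2]
  refine mul_ne_zero hρ.ne' fun h0 => ?_
  have := sin_sq_add_cos_sq (θ x)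
  rw [h0, (h.cos_eq_zero_iff x).2 hx] at this
  norm_num at this

/-- `A B` is a positive multiple of `sin (2 θ)`, and `2 θ x` is an odd multiple of `π` at a zero `x`
of `A`; this produces the minus sign. -/
theorem eval_mul_eval (h : IsPhase θ A B) {x : ℝ} (hx : A.IsRoot x) (y : ℝ) :
    ∃ c : ℝ, 0 < c ∧ A.eval y * B.eval y = -(c * sin (2 * (θ y - θ x))) := by
  obtain ⟨ρ, hρ, h1, h2⟩ := h.polar y
  refine ⟨ρ ^ 2 / 2, by positivity, ?_⟩
  rw [h1, h2]
  have hc := (h.cos_eq_zero_iff x).2 hx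
  have hs : sin (θ x) ^ 2 = 1 := by
    have := sin_sq_add_cos_sq (θ x)
    rw [hc] at this
    linarith
  rw [mul_sub, sin_sub, sin_two_mul, sin_two_mul (θ x), cos_two_mul (θ x), hc]
  ring

theorem eventually_abs_sub_lt (h : IsPhase θ A B) (x : ℝ) {ε : ℝ} (hε : 0 < ε) :
    ∀ᶠ y in 𝓝 x, |θ y - θ x| < ε := by
  have := h.continuous.continuousAt.eventually (Metric.ball_mem_nhds (θ x) hε)
  filter_upwards [this] with y hy
  simpa [Real.dist_eq] using hy

/-- Near a zero of `A`, the sign of `A B` determines the direction of the phase. -/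
theorem eventually_sign (h : IsPhase θ A B) {x : ℝ} (hx : A.IsRoot x) : ∀ᶠ y in 𝓝 x,
    (A.eval y * B.eval y < 0 ↔ θ x < θ y) ∧ (0 < A.eval y * B.eval y ↔ θ y < θ x) := by
  filter_upwards [h.eventually_abs_sub_lt x (half_pos pi_pos)] with y hy
  obtain ⟨c, hc, he⟩ := h.eval_mul_eval hx y
  rw [he]
  obtain ⟨h1, h2⟩ := abs_lt.1 hy
  rcases lt_trichotomy (θ y) (θ x) with hlt | heq | hgt
  · have : 0 < sin (-(2 * (θ y - θ x))) := sin_pos_of_pos_of_lt_pi (by linarith) (by linarith)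
    rw [sin_neg] at this
    have := mul_pos hc this
    constructor <;> constructor <;> intro _ <;> linarith
  · simp [heq]
  · have : 0 < sin (2 * (θ y - θ x)) := sin_pos_of_pos_of_lt_pi (by linarith) (by linarith)
    have := mul_pos hc this
    constructor <;> constructor <;> intro _ <;> linarith

theorem deriv_mul {x : ℝ} (hx : A.IsRoot x) :
    deriv (fun y => A.eval y * B.eval y) x = A.derivative.eval x * B.eval x := by
  have h0 : A.eval x = 0 := hx
  have := ((A.hasDerivAt x).mul (B.hasDerivAt x)).deriv
  rw [h0, zero_mul, add_zero] at this
  exact this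

/-- The derivative of `A B` at a zero of `A` is `A' B`; where it is negative, `A B` changes sign
from plus to minus, so the phase crosses upwards. -/
theorem eventually_lt_of_neg (h : IsPhase θ A B) {x : ℝ} (hx : A.IsRoot x)
    (hd : A.derivative.eval x * B.eval x < 0) :
    ∀ᶠ y in 𝓝 x, (x < y → θ x < θ y) ∧ (y < x → θ y < θ x) := by
  have h0 : A.eval x = 0 := hx
  have hs := eventually_nhdsWithin_sign_eq_of_deriv_neg
    (f := fun y => A.eval y * B.eval y) (x₀ := x) (by rwa [deriv_mul hx]) (by simp [h0])
  filter_upwards [hs, h.eventually_sign hx] with y hy hy'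
  refine ⟨fun hxy => hy'.1.1 ?_, fun hxy => hy'.2.1 ?_⟩
  · rwa [sign_neg (sub_neg.2 hxy), sign_eq_neg_one_iff] at hy
  · rwa [sign_pos (sub_pos.2 hxy), sign_eq_one_iff] at hy

theorem eventually_lt_of_pos (h : IsPhase θ A B) {x : ℝ} (hx : A.IsRoot x)
    (hd : 0 < A.derivative.eval x * B.eval x) :
    ∀ᶠ y in 𝓝 x, (x < y → θ y < θ x) ∧ (y < x → θ x < θ y) := by
  have h0 : A.eval x = 0 := hx
  have hs := eventually_nhdsWithin_sign_eq_of_deriv_pos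
    (f := fun y => A.eval y * B.eval y) (x₀ := x) (by rwa [deriv_mul hx]) (by simp [h0])
  filter_upwards [hs, h.eventually_sign hx] with y hy hy'
  refine ⟨fun hxy => hy'.2.1 ?_, fun hxy => hy'.1.1 ?_⟩
  · rwa [sign_pos (sub_pos.2 hxy), sign_eq_one_iff] at hy
  · rwa [sign_neg (sub_neg.2 hxy), sign_eq_neg_one_iff] at hy

end IsPhase

end Phase

/-! ### Counting crossings of odd multiples of `π / 2`. -/

section Phase

open Filter Topology Real

/-- The number of half turns made by the phase `t`, counted at odd multiples of `π / 2`. -/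
noncomputable def halfTurns (t : ℝ) : ℤ := ⌊t / π + 1 / 2⌋

theorem halfTurns_eq_iff {t : ℝ} {j : ℤ} :
    halfTurns t = j ↔ (j - 1 / 2) * π ≤ t ∧ t < (j + 1 / 2) * π := by
  rw [halfTurns, Int.floor_eq_iff, ← sub_le_iff_le_add, le_div_iff₀ pi_pos, ← lt_sub_iff_add_lt,
    div_lt_iff₀ pi_pos]
  ring_nf

theorem exists_eq_of_cos_eq_zero {t : ℝ} (h : cos t = 0) : ∃ j : ℤ, t = (j - 1 / 2) * π := by
  obtain ⟨i, hi⟩ := Real.cos_eq_zero_iff.1 h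
  refine ⟨i + 1, ?_⟩
  rw [hi]; push_cast; ring

theorem cos_half_odd_mul_pi (j : ℤ) : cos ((j - 1 / 2) * π) = 0 := by
  rw [Real.cos_eq_zero_iff]
  refine ⟨j - 1, ?_⟩
  push_cast; ring

/-- The contribution of the zero `l` to the step function compensating the jumps of the number of
half turns. -/
noncomputable def jumpCorrection (l y : ℝ) : ℤ :=
  -- The floor in `halfTurns` assigns the crossing level to the upper side. An upward crossing
  -- therefore jumps at `l` itself, and a downward one only strictly after `l`; hence `≤` and `<`.
  if 0 < l then (if l ≤ y then -1 else 0) else (if l < y then 1 else 0)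

theorem eventually_jumpCorrection_eq {l x : ℝ} (h : l ≠ x) :
    ∀ᶠ y in 𝓝 x, jumpCorrection l y = jumpCorrection l x := by
  rcases lt_or_gt_of_ne h with h | h
  · filter_upwards [eventually_gt_nhds h] with y hy
    simp [jumpCorrection, h, h.le, hy, hy.le]
  · filter_upwards [eventually_lt_nhds h] with y hy
    simp [jumpCorrection, h.not_ge, h.not_gt, hy.not_ge, hy.not_gt]

namespace IsPhase

variable {θ : ℝ → ℝ} {A B : ℝ[X]}

theorem eventually_halfTurns_eq (h : IsPhase θ A B) {x : ℝ} (hx : ¬ A.IsRoot x) :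
    ∀ᶠ y in 𝓝 x, halfTurns (θ y) = halfTurns (θ x) := by
  obtain ⟨h1, h2⟩ := halfTurns_eq_iff.1 (rfl : halfTurns (θ x) = _)
  have h3 : (halfTurns (θ x) - 1 / 2) * π < θ x := by
    refine lt_of_le_of_ne h1 fun he => hx ((h.cos_eq_zero_iff x).1 ?_)
    rw [← he, cos_half_odd_mul_pi]
  filter_upwards [h.continuous.continuousAt.eventually (eventually_gt_nhds h3),
    h.continuous.continuousAt.eventually (eventually_lt_nhds h2)] with y hy1 hy2
  exact halfTurns_eq_iff.2 ⟨hy1.le, hy2⟩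

theorem eventually_halfTurns_add_eq (h : IsPhase θ A B)
    (hc : ∀ x, A.IsRoot x → x * (A.derivative.eval x * B.eval x) < 0) {x : ℝ} (hx : A.IsRoot x) :
    ∀ᶠ y in 𝓝 x, halfTurns (θ y) + jumpCorrection x y =
      halfTurns (θ x) + jumpCorrection x x := by
  obtain ⟨j, hj⟩ := exists_eq_of_cos_eq_zero ((h.cos_eq_zero_iff x).2 hx)
  have hπ := pi_pos
  have hjx : halfTurns (θ x) = j := halfTurns_eq_iff.2 (by rw [hj]; constructor <;> linarith)
  have hup : ∀ y, |θ y - θ x| < π → θ x ≤ θ y → halfTurns (θ y) = j := fun y hy hle => by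
    obtain ⟨h1, h2⟩ := abs_lt.1 hy
    exact halfTurns_eq_iff.2 (by constructor <;> linarith)
  have hdown : ∀ y, |θ y - θ x| < π → θ y < θ x → halfTurns (θ y) = j - 1 := fun y hy hlt => by
    obtain ⟨h1, h2⟩ := abs_lt.1 hy
    refine halfTurns_eq_iff.2 ?_
    push_cast
    constructor <;> linarith
  have hx0 : x ≠ 0 := left_ne_zero_of_mul (hc x hx).ne
  rcases lt_or_gt_of_ne hx0 with hneg | hpos
  · have hd := pos_of_mul_neg_right (hc x hx) hneg.le
    filter_upwards [h.eventually_abs_sub_lt x hπ, h.eventually_lt_of_pos hx hd] with y hy hy'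
    rw [hjx, jumpCorrection, jumpCorrection, if_neg hneg.not_gt, if_neg hneg.not_gt,
      if_neg (lt_irrefl x)]
    by_cases hxy : x < y
    · rw [if_pos hxy, hdown y hy (hy'.1 hxy)]; ring
    · rw [if_neg hxy, hup y hy]
      rcases (not_lt.1 hxy).eq_or_lt with he | hlt
      · rw [he]
      · exact (hy'.2 hlt).le
  · have hd := neg_of_mul_neg_right (hc x hx) hpos.le
    filter_upwards [h.eventually_abs_sub_lt x hπ, h.eventually_lt_of_neg hx hd] with y hy hy'
    rw [hjx, jumpCorrection, jumpCorrection, if_pos hpos, if_pos hpos, if_pos le_rfl]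
    by_cases hxy : x ≤ y
    · rw [if_pos hxy, hup y hy]
      rcases hxy.eq_or_lt with he | hlt
      · rw [he]
      · exact (hy'.1 hlt).le
    · rw [if_neg hxy, hdown y hy (hy'.2 (not_le.1 hxy))]; ring

/-- The corrections cancel every jump of `halfTurns ∘ θ`, so the sum is locally constant on the
connected real line. -/
theorem halfTurns_add_sum_eq (h : IsPhase θ A B) (hA : A ≠ 0)
    (hc : ∀ x, A.IsRoot x → x * (A.derivative.eval x * B.eval x) < 0) (x y : ℝ) :
    halfTurns (θ x) + ∑ l ∈ A.roots.toFinset, jumpCorrection l x =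
      halfTurns (θ y) + ∑ l ∈ A.roots.toFinset, jumpCorrection l y := by
  set s := A.roots.toFinset with hs
  have hmem : ∀ x, x ∈ s ↔ A.IsRoot x := fun x => by rw [hs, Multiset.mem_toFinset, mem_roots hA]
  have hloc : IsLocallyConstant fun x => halfTurns (θ x) + ∑ l ∈ s, jumpCorrection l x := by
    rw [IsLocallyConstant.iff_eventually_eq]
    intro x
    have hrest : ∀ᶠ y in 𝓝 x, ∀ l ∈ s.erase x, jumpCorrection l y = jumpCorrection l x :=
      (eventually_all_finset _).2 fun l hl => eventually_jumpCorrection_eq (Finset.ne_of_mem_erase hl)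
    by_cases hx : x ∈ s
    · filter_upwards [hrest, h.eventually_halfTurns_add_eq hc ((hmem x).1 hx)] with y hy hy'
      rw [← Finset.add_sum_erase s _ hx, ← Finset.add_sum_erase s _ hx, Finset.sum_congr rfl hy,
        ← add_assoc, hy', add_assoc]
    · rw [Finset.erase_eq_of_notMem hx] at hrest
      filter_upwards [hrest, h.eventually_halfTurns_eq (mt (hmem x).2 hx)] with y hy hy'
      rw [Finset.sum_congr rfl hy, hy']
  exact hloc.apply_eq_of_isPreconnected isPreconnected_univ (Set.mem_univ x) (Set.mem_univ y)

theorem eventually_halfTurns_of_tendsto {l : Filter ℝ} {j : ℤ} (h : Tendsto θ l (𝓝 (j * π))) :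
    ∀ᶠ x in l, halfTurns (θ x) = j := by
  have hπ := pi_pos
  filter_upwards [h.eventually (eventually_gt_nhds (show (j - 1 / 2) * π < j * π by linarith)),
    h.eventually (eventually_lt_nhds (show j * π < (j + 1 / 2) * π by linarith))] with x h1 h2
  exact halfTurns_eq_iff.2 ⟨h1.le, h2⟩

/-- If the phase crosses the imaginary axis upwards at all positive zeros of `A` and downwards at
all negative zeros, the numbers of these zeros and the value of the phase at `0` follow. -/
theorem card_roots_of_crossing (h : IsPhase θ A B) (hA : A ≠ 0)
    (hc : ∀ x, A.IsRoot x → x * (A.derivative.eval x * B.eval x) < 0) {Np Nm : ℕ} {S : ℝ}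
    (hcard : A.roots.toFinset.card = Np + Nm) (htop : Tendsto θ atTop (𝓝 0))
    (hbot : Tendsto θ atBot (𝓝 ((Nm - Np) * π))) (h0 : θ 0 = S - Np * π) :
    (A.roots.toFinset.filter fun x => 0 < x).card = Np ∧
      (A.roots.toFinset.filter fun x => x < 0).card = Nm ∧ -(π / 2) ≤ S ∧ S < π / 2 := by
  have hconst := h.halfTurns_add_sum_eq hA hc
  set s := A.roots.toFinset with hs
  have hs0 : ∀ x ∈ s, x ≠ 0 := fun x hx =>
    left_ne_zero_of_mul (hc x (isRoot_of_mem_roots (Multiset.mem_toFinset.1 hx))).ne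
  have hsplit : (s.filter fun x => 0 < x).card + (s.filter fun x => x < 0).card = s.card := by
    rw [← Finset.card_filter_add_card_filter_not (s := s) (fun x => 0 < x)]
    congr 2
    refine Finset.filter_congr fun x hx => ?_
    rw [not_lt]
    exact ⟨le_of_lt, fun hle => lt_of_le_of_ne hle (hs0 x hx)⟩
  have hzero : ∑ l ∈ s, jumpCorrection l 0 = (s.filter fun x => x < 0).card := by
    rw [Finset.card_filter]
    push_cast
    refine Finset.sum_congr rfl fun l hl => ?_
    rcases lt_or_gt_of_ne (hs0 l hl) with h | h
    · simp [jumpCorrection, h, h.not_gt]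
    · simp [jumpCorrection, h, h.not_gt, h.not_ge]
  -- Sample the invariant to the right and to the left of all zeros, where the number of half turns
  -- has reached its limit.
  obtain ⟨M, hM1, hM2⟩ : ∃ M, halfTurns (θ M) = 0 ∧ ∀ l ∈ s, l < M := by
    have h1 : ∀ᶠ x in atTop, halfTurns (θ x) = 0 :=
      eventually_halfTurns_of_tendsto (by simpa using htop)
    exact (h1.and ((eventually_all_finset s).2 fun l _ => eventually_gt_atTop l)).exists
  obtain ⟨M', hM1', hM2'⟩ : ∃ M, halfTurns (θ M) = Nm - Np ∧ ∀ l ∈ s, M < l := by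
    have h1 : ∀ᶠ x in atBot, halfTurns (θ x) = Nm - Np :=
      eventually_halfTurns_of_tendsto (by push_cast; exact hbot)
    exact (h1.and ((eventually_all_finset s).2 fun l _ => eventually_lt_atBot l)).exists
  have htopsum : ∑ l ∈ s, jumpCorrection l M =
      (s.filter fun x => x < 0).card - (s.filter fun x => 0 < x).card := by
    rw [Finset.card_filter, Finset.card_filter]
    push_cast
    rw [← Finset.sum_sub_distrib]
    refine Finset.sum_congr rfl fun l hl => ?_
    have hlM := hM2 l hl
    rcases lt_or_gt_of_ne (hs0 l hl) with h | h
    · simp [jumpCorrection, h, h.not_gt, hlM]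
    · simp [jumpCorrection, h, h.not_gt, hlM.le]
  have hbotsum : ∑ l ∈ s, jumpCorrection l M' = 0 := by
    refine Finset.sum_eq_zero fun l hl => ?_
    have hlM := hM2' l hl
    simp [jumpCorrection, hlM.not_ge, hlM.not_gt]
  have e1 := hconst 0 M
  have e2 := hconst 0 M'
  rw [hzero, htopsum, hM1] at e1
  rw [hzero, hbotsum, hM1'] at e2
  -- The samples give the difference of the numbers of negative and positive zeros as `Nm - Np`;
  -- `hcard` gives their sum.
  have hp : (s.filter fun x => 0 < x).card = Np := by omega
  refine ⟨hp, by omega, ?_⟩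
  have e3 : halfTurns (θ 0) = -(Np : ℤ) := by omega
  obtain ⟨h1, h2⟩ := halfTurns_eq_iff.1 e3
  rw [h0] at h1 h2
  push_cast at h1 h2
  constructor <;> linarith

end IsPhase

/-! ### Forcing real zeros by the intermediate value theorem. -/

theorem exists_gt_eq_of_tendsto_atTop {f : ℝ → ℝ} (hf : Continuous f) {a c d : ℝ} (ha : f a < c)
    (hd : Tendsto f atTop (𝓝 d)) (hcd : c < d) : ∃ x, a < x ∧ f x = c := by
  obtain ⟨b, hb, hab⟩ := ((hd.eventually (eventually_gt_nhds hcd)).and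
    (eventually_gt_atTop a)).exists
  obtain ⟨x, hx, hfx⟩ := intermediate_value_Ioo hab.le hf.continuousOn (Set.mem_Ioo.2 ⟨ha, hb⟩)
  exact ⟨x, hx.1, hfx⟩

theorem lt_of_unique_crossing {f : ℝ → ℝ} (hf : Continuous f) {c d x : ℝ}
    (hd : Tendsto f atTop (𝓝 d)) (hcd : c < d) (huniq : ∀ y, x < y → f y ≠ c) {y : ℝ}
    (hy : x < y) : c < f y := by
  by_contra hle
  obtain ⟨z, hz, hfz⟩ := exists_gt_eq_of_tendsto_atTop hf
    (lt_of_le_of_ne (not_lt.1 hle) (huniq y hy)) hd hcd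
  exact huniq z (hy.trans hz) hfz

namespace IsPhase

variable {θ : ℝ → ℝ} {A B : ℝ[X]}

/-- If the phase at `0` is close enough to its value forced at infinity, `A` has only real zeros
and the phase crosses the imaginary axis upwards at the positive and downwards at the negative
ones. -/
theorem splits_and_crossing (h : IsPhase θ A B) (hA : A ≠ 0) {Np Nm : ℕ} {S : ℝ}
    (hdeg : A.natDegree = Np + Nm) (htop : Tendsto θ atTop (𝓝 0))
    (hbot : Tendsto θ atBot (𝓝 ((Nm - Np) * π))) (h0 : θ 0 = S - Np * π)
    (hS : S < π / 2) (hS0 : -(π / 2) < S) :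
    A.Splits ∧ ∀ x, A.IsRoot x → x * (A.derivative.eval x * B.eval x) < 0 := by
  have hπ := pi_pos
  have hneg : Tendsto (fun x => θ (-x)) atTop (𝓝 ((Nm - Np) * π)) := hbot.comp tendsto_neg_atTop_atBot
  have hcneg : Continuous fun x => θ (-x) := h.continuous.comp continuous_neg
  have hlt : ∀ {i N : ℕ}, i < N → ((i : ℝ) + 1) * π ≤ N * π := fun {i N} hi =>
    mul_le_mul_of_nonneg_right (by exact_mod_cast hi) hπ.le
  -- On each half-axis, list the odd multiples of `π / 2` lying between `θ 0` and the limit at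
  -- infinity. The condition `S < π / 2` keeps `θ 0` below all of them.
  have hex1 : ∀ i : Fin Np, ∃ x, 0 < x ∧ θ x = -((i : ℝ) + 1 / 2) * π := fun i =>
    exists_gt_eq_of_tendsto_atTop h.continuous (by rw [h0]; linarith [hlt i.2]) htop
      (by have := mul_nonneg (Nat.cast_nonneg (α := ℝ) (i : ℕ)) hπ.le; linarith)
  have hex2 : ∀ i : Fin Nm, ∃ x, 0 < x ∧ θ (-x) = ((i : ℝ) + 1 / 2 - Np) * π := fun i => by
    refine exists_gt_eq_of_tendsto_atTop (f := fun x => θ (-x)) hcneg ?_ hneg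
      (by linarith [hlt i.2])
    have := mul_nonneg (Nat.cast_nonneg (α := ℝ) (i : ℕ)) hπ.le
    rw [neg_zero, h0]; linarith
  choose f hf0 hf using hex1
  choose g hg0 hg using hex2
  have hroot : ∀ {x : ℝ} {j : ℤ}, θ x = (j - 1 / 2) * π → A.IsRoot x := fun {x j} hx =>
    (h.cos_eq_zero_iff x).1 (by rw [hx, cos_half_odd_mul_pi])
  have hrootp : ∀ {x : ℝ} {i : ℕ}, θ x = -((i : ℝ) + 1 / 2) * π → A.IsRoot x := fun {x i} hx =>
    hroot (j := -(i : ℤ)) (by rw [hx]; push_cast; ring)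
  have hrootm : ∀ {x : ℝ} {i : ℕ}, θ x = ((i : ℝ) + 1 / 2 - Np) * π → A.IsRoot x :=
    fun {x i} hx => hroot (j := (i : ℤ) + 1 - Np) (by rw [hx]; push_cast; ring)
  have hfinj : Function.Injective f := fun i j hij => by
    have := (hf i).symm.trans ((congrArg θ hij).trans (hf j))
    have := mul_right_cancel₀ hπ.ne' this
    exact Fin.ext (by exact_mod_cast (by linarith : ((i : ℕ) : ℝ) = (j : ℕ)))
  have hginj : Function.Injective g := fun i j hij => by
    have := (hg i).symm.trans ((congrArg (fun x => θ (-x)) hij).trans (hg j))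
    have := mul_right_cancel₀ hπ.ne' this
    exact Fin.ext (by exact_mod_cast (by linarith : ((i : ℕ) : ℝ) = (j : ℕ)))
  let F : Fin Np ⊕ Fin Nm → ℝ := Sum.elim f fun i => -g i
  have hFinj : Function.Injective F := by
    refine hfinj.sumElim (neg_injective.comp hginj) fun i j hij => ?_
    have h1 := hf0 i
    have h2 := hg0 j
    linarith
  have hsub : Finset.univ.image F ⊆ A.roots.toFinset := by
    intro x hx
    obtain ⟨i, -, rfl⟩ := Finset.mem_image.1 hx
    rw [Multiset.mem_toFinset, mem_roots hA]
    rcases i with i | i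
    · exact hrootp (hf i)
    · exact hrootm (hg i)
  have hcardF : (Finset.univ.image F).card = Np + Nm := by
    rw [Finset.card_image_of_injective _ hFinj]; simp
  have hle1 : A.roots.toFinset.card ≤ A.roots.card := Multiset.toFinset_card_le _
  have hle2 : A.roots.card ≤ Np + Nm := hdeg ▸ card_roots' A
  -- The degree leaves no room for further zeros, so every zero is simple and every listed level is
  -- attained exactly once on its half-axis.
  have heq : Finset.univ.image F = A.roots.toFinset :=
    Finset.eq_of_subset_of_card_le hsub (by omega)
  have hcard : A.roots.toFinset.card = Np + Nm := heq ▸ hcardF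
  have hnodup : A.roots.Nodup := Multiset.toFinset_card_eq_card_iff_nodup.1 (by omega)
  refine ⟨splits_iff_card_roots.2 (by omega), fun x hx => ?_⟩
  have hd0 : A.derivative.eval x ≠ 0 := fun hd => by
    have := (one_lt_rootMultiplicity_iff_isRoot hA).2 ⟨hx, hd⟩
    rw [← count_roots] at this
    exact absurd (Multiset.nodup_iff_count_le_one.1 hnodup x) (not_le.2 this)
  have hB := h.eval_right_ne_zero hx
  have hall : ∀ y, A.IsRoot y → ∃ i, F i = y := fun y hy => by
    have : y ∈ Finset.univ.image F := by rw [heq, Multiset.mem_toFinset, mem_roots hA]; exact hy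
    simpa using this
  obtain ⟨i, hi⟩ := hall x hx
  rcases i with i | i
  · have hix : f i = x := hi
    subst hix
    -- The level is not attained again further right and the limit is above it, so the phase stays
    -- above. A positive `A' B` would make it drop just after the zero.
    have hafter : ∀ y, f i < y → θ (f i) < θ y := fun y hy => by
      refine lt_of_unique_crossing h.continuous htop ?_ (fun z hz hez => ?_) hy
      · rw [hf i]
        have := mul_nonneg (Nat.cast_nonneg (α := ℝ) (i : ℕ)) hπ.le
        linarith
      · rw [hf i] at hez
        obtain ⟨j, hj⟩ := hall z (hrootp hez)
        rcases j with j | j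
        · have hjz : f j = z := hj
          subst hjz
          rw [hf j] at hez
          have := mul_right_cancel₀ hπ.ne' hez
          have : j = i := Fin.ext (by exact_mod_cast (by linarith : ((j : ℕ) : ℝ) = (i : ℕ)))
          exact hz.ne (by rw [this])
        · have hjz : -g j = z := hj
          linarith [hf0 i, hg0 j]
    refine mul_neg_of_pos_of_neg (hf0 i) (lt_of_le_of_ne (not_lt.1 fun hpos => ?_)
      (mul_ne_zero hd0 hB))
    have hev := (h.eventually_lt_of_pos hx hpos).filter_mono
      (nhdsWithin_le_nhds (s := Set.Ioi (f i)))
    obtain ⟨y, hy, hy'⟩ := (hev.and self_mem_nhdsWithin).exists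
    exact lt_asymm (hy.1 hy') (hafter y hy')
  · have hix : -g i = x := hi
    subst hix
    have hafter : ∀ y, y < -g i → θ (-g i) < θ y := fun y hy => by
      have := lt_of_unique_crossing (f := fun x => θ (-x)) (c := θ (-g i)) (x := g i) (y := -y)
        hcneg hneg ?_ (fun z hz hez => ?_) (lt_neg_of_lt_neg hy)
      · simpa using this
      · rw [hg i]
        linarith [hlt i.2]
      · rw [hg i] at hez
        obtain ⟨j, hj⟩ := hall (-z) (hrootm hez)
        rcases j with j | j
        · have hjz : f j = -z := hj
          linarith [hf0 j, hg0 i]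
        · have hjz : -g j = -z := hj
          rw [← hjz, hg j] at hez
          have := mul_right_cancel₀ hπ.ne' hez
          have : j = i := Fin.ext (by exact_mod_cast (by linarith : ((j : ℕ) : ℝ) = (i : ℕ)))
          rw [this] at hjz
          linarith
    refine mul_neg_of_neg_of_pos (neg_neg_of_pos (hg0 i)) (lt_of_le_of_ne (not_lt.1 fun hlt0 => ?_)
      (mul_ne_zero hd0 hB).symm)
    have hev := (h.eventually_lt_of_neg hx hlt0).filter_mono
      (nhdsWithin_le_nhds (s := Set.Iio (-g i)))
    obtain ⟨y, hy, hy'⟩ := (hev.and self_mem_nhdsWithin).exists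
    exact lt_asymm (hy.2 hy') (hafter y hy')

end IsPhase

end Phase

/-! ### Real and imaginary parts of complex polynomials, and the factor `X`. -/

section Complexify

/-- The complex polynomial `A + i B`. -/
noncomputable def complexify (A B : ℝ[X]) : ℂ[X] :=
  A.map (algebraMap ℝ ℂ) + C Complex.I * B.map (algebraMap ℝ ℂ)

variable {A B : ℝ[X]}

theorem coeff_complexify (A B : ℝ[X]) (j : ℕ) :
    (complexify A B).coeff j = A.coeff j + B.coeff j * Complex.I := by
  simp [complexify, mul_comm]

theorem eval_complexify (A B : ℝ[X]) (x : ℝ) :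
    (complexify A B).eval (x : ℂ) = (A.eval x : ℝ) + (B.eval x : ℝ) * Complex.I := by
  have h : ∀ D : ℝ[X], (D.map (algebraMap ℝ ℂ)).eval (x : ℂ) = (D.eval x : ℝ) := fun D => by
    rw [eval_map_algebraMap, ← Complex.coe_algebraMap, aeval_algebraMap_apply, coe_aeval_eq_eval]
  rw [complexify, eval_add, eval_mul, eval_C, h, h, mul_comm]

theorem re_coeff_complexify (A B : ℝ[X]) (j : ℕ) : ((complexify A B).coeff j).re = A.coeff j := by
  simp [coeff_complexify]

theorem im_coeff_complexify (A B : ℝ[X]) (j : ℕ) : ((complexify A B).coeff j).im = B.coeff j := by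
  simp [coeff_complexify]

theorem complexify_injective {A' B' : ℝ[X]} (h : complexify A B = complexify A' B') :
    A = A' ∧ B = B' := by
  constructor <;> ext j
  · rw [← re_coeff_complexify A B, h, re_coeff_complexify]
  · rw [← im_coeff_complexify A B, h, im_coeff_complexify]

theorem exists_complexify_eq (R : ℂ[X]) : ∃ A B : ℝ[X], complexify A B = R := by
  induction R using Polynomial.induction_on' with
  | add p q hp hq =>
    obtain ⟨A, B, rfl⟩ := hp
    obtain ⟨A', B', rfl⟩ := hq
    refine ⟨A + A', B + B', ?_⟩
    simp only [complexify, Polynomial.map_add]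
    ring
  | monomial n a =>
    refine ⟨monomial n a.re, monomial n a.im, ?_⟩
    rw [complexify, map_monomial, map_monomial, C_mul_monomial, ← map_add]
    congr 1
    rw [mul_comm]
    exact Complex.re_add_im a

theorem complexify_degree_iff {m : ℕ} : ((complexify A B).Monic ∧ (complexify A B).natDegree = m) ↔
    (A.Monic ∧ A.natDegree = m) ∧ B.degree < m := by
  have key : ∀ {K : Type} [Field K] (D : K[X]), (D.Monic ∧ D.natDegree = m) ↔
      (∀ j, m ≤ j → D.coeff j = if j = m then 1 else 0) := by
    intro K _ D
    constructor
    · rintro ⟨h1, rfl⟩ j hj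
      split_ifs with h
      · rw [h]; exact h1
      · exact coeff_eq_zero_of_natDegree_lt (by omega)
    · intro h
      have h1 : D.natDegree = m := by
        refine le_antisymm (natDegree_le_iff_coeff_eq_zero.2 fun j hj => ?_)
          (le_natDegree_of_ne_zero ?_)
        · rw [h j hj.le, if_neg hj.ne']
        · rw [h m le_rfl, if_pos rfl]; exact one_ne_zero
      refine ⟨?_, h1⟩
      rw [Monic, leadingCoeff, h1, h m le_rfl, if_pos rfl]
  rw [key, key, degree_lt_iff_coeff_zero, ← forall_and]
  refine forall_congr' fun j => ?_
  rw [← forall_and]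
  refine forall_congr' fun hj => ?_
  rw [Complex.ext_iff, re_coeff_complexify, im_coeff_complexify]
  split_ifs <;> simp

end Complexify

namespace Interlaced

variable {m : ℕ} {A q : ℝ[X]}

theorem residue_pos_of_X_mul (h : Interlaced m (X * A) q) {x : ℝ} (hx : A.IsRoot x) :
    0 < x * (A.derivative.eval x * q.eval x) := by
  have h0 : A.eval x = 0 := hx
  have := h.residue_pos x (by rw [IsRoot, eval_mul, h0, mul_zero])
  rw [derivative_mul, eval_add, eval_mul, eval_mul, h0, derivative_X, eval_X] at this
  simpa [mul_assoc] using this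

theorem eval_zero_pos_of_X_mul (h : Interlaced m (X * A) q) : 0 < A.eval 0 * q.eval 0 := by
  have := h.residue_pos 0 (by simp)
  simpa [derivative_mul] using this

theorem monic_of_X_mul (h : Interlaced m (X * A) q) : A.Monic :=
  monic_X.of_mul_monic_left h.monic_left

theorem natDegree_of_X_mul (h : Interlaced m (X * A) q) : A.natDegree = m := by
  have := h.natDegree_left
  rw [natDegree_X_mul h.monic_of_X_mul.ne_zero] at this
  omega

theorem of_X_mul (hA : A.Monic) (hm : A.natDegree = m) (hq : q.Monic) (hqm : q.natDegree = m)
    (hs : A.Splits) (h : ∀ x, A.IsRoot x → 0 < x * (A.derivative.eval x * q.eval x))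
    (h0 : 0 < A.eval 0 * q.eval 0) : Interlaced m (X * A) q := by
  refine ⟨monic_X.mul hA, by rw [natDegree_X_mul hA.ne_zero, hm], hq, hqm, splits_X_mul.2 hs, ?_⟩
  intro x hx
  rw [derivative_mul, eval_add, eval_mul, eval_mul, derivative_X, eval_X, eval_one, one_mul]
  rw [IsRoot, eval_mul, eval_X, mul_eq_zero] at hx
  rcases hx with rfl | hx
  · simpa using h0
  · rw [hx, zero_add, mul_assoc]
    exact h x hx

end Interlaced

theorem complexify_mul_X {A q : ℝ[X]} (k : ℝ) :
    C (1 + Complex.I * k) * (X * A).map (algebraMap ℝ ℂ) -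
      C (Complex.I * k) * (X * q.map (algebraMap ℝ ℂ)) = X * complexify A (C k * (A - q)) := by
  simp only [complexify, Polynomial.map_mul, map_X, Polynomial.map_sub, map_C, C_add, C_mul, C_1,
    Complex.coe_algebraMap]
  ring

theorem prod_sub_eq_eval {Z : Multiset ℂ} (x : ℂ) :
    (Z.map fun z => x - z).prod = ((Z.map fun z => X - C z).prod).eval x := by
  rw [eval_multiset_prod, Multiset.map_map]
  simp

open Real in
/-- The value at `0` of the phase is smaller than `arctan k` iff the residue at `0` is positive. -/
theorem IsPhase.eval_zero_pos_iff {θ : ℝ → ℝ} {A q : ℝ[X]} {k S : ℝ} {N : ℕ} (hk : 0 < k)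
    (h : IsPhase θ A (C k * (A - q))) (h0 : θ 0 = S - N * π) (hS : S < π / 2)
    (hS0 : -(π / 2) < S) : 0 < A.eval 0 * q.eval 0 ↔ S < arctan k := by
  obtain ⟨ρ, hρ, h1, h2⟩ := h.polar 0
  have hcos := cos_pos_of_mem_Ioo ⟨hS0, hS⟩
  rw [h0, cos_sub_nat_mul_pi] at h1
  rw [h0, sin_sub_nat_mul_pi, eval_mul, eval_C, eval_sub] at h2
  have hN : ((-1 : ℝ) ^ N) ^ 2 = 1 := by rw [← pow_mul, mul_comm, pow_mul]; simp
  -- Substitute `k q = k A - B` with `A` and `B` in polar form at `0`; the sign from the shift by `N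
  -- π` is squared away.
  have e : k * (A.eval 0 * q.eval 0) = ρ ^ 2 * cos S * (k * cos S - sin S) := by
    have : k * q.eval 0 = k * A.eval 0 - ρ * ((-1) ^ N * sin S) := by rw [← h2]; ring
    calc k * (A.eval 0 * q.eval 0) = A.eval 0 * (k * q.eval 0) := by ring
      _ = ((-1 : ℝ) ^ N) ^ 2 * (ρ ^ 2 * cos S * (k * cos S - sin S)) := by rw [this, h1]; ring
      _ = _ := by rw [hN, one_mul]
  have e1 : 0 < A.eval 0 * q.eval 0 ↔ 0 < k * cos S - sin S := by
    rw [← mul_pos_iff_of_pos_left hk, e, mul_pos_iff_of_pos_left (by positivity)]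
  have e2 : S < arctan k ↔ tan S < k := by
    conv_lhs => rw [← arctan_tan hS0 hS]
    exact arctan_strictMono.lt_iff_lt
  rw [e1, e2, tan_eq_sin_div_cos, div_lt_iff₀ hcos, sub_pos]

theorem countP_roots_X_mul {A : ℝ[X]} (hA : A ≠ 0) (hn : A.roots.Nodup) (p : ℝ → Prop)
    [DecidablePred p] (hp : ¬ p 0) :
    (X * A).roots.countP p = (A.roots.toFinset.filter p).card := by
  rw [roots_mul (mul_ne_zero X_ne_zero hA), roots_X, Multiset.singleton_add,
    Multiset.countP_cons_of_neg _ hp, Multiset.countP_eq_card_filter, Finset.card_def,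
    Finset.filter_val, Multiset.toFinset_val, hn.dedup]

theorem roots_X_mul_complexify {A B : ℝ[X]} (h : complexify A B ≠ 0) :
    (X * complexify A B).roots = 0 ::ₘ (complexify A B).roots := by
  rw [roots_mul (mul_ne_zero X_ne_zero h), roots_X, Multiset.singleton_add]

theorem Interlaced.monic_complexify {m : ℕ} {A q : ℝ[X]} (h : Interlaced m (X * A) q) (k : ℝ) :
    (complexify A (C k * (A - q))).Monic ∧ (complexify A (C k * (A - q))).natDegree = m := by
  refine complexify_degree_iff.2 ⟨⟨h.monic_of_X_mul, h.natDegree_of_X_mul⟩, ?_⟩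
  have h1 : (A - q).degree < A.degree := degree_sub_lt_left
    (by rw [degree_eq_natDegree h.monic_of_X_mul.ne_zero,
      degree_eq_natDegree h.monic_right.ne_zero, h.natDegree_of_X_mul, h.natDegree_right])
    h.monic_of_X_mul.ne_zero (by rw [h.monic_of_X_mul.leadingCoeff, h.monic_right.leadingCoeff])
  rw [degree_eq_natDegree h.monic_of_X_mul.ne_zero, h.natDegree_of_X_mul] at h1
  by_cases hk : k = 0
  · simp [hk]
  · rwa [degree_C_mul hk]

/-! ### The direct and inverse problems for polynomials. -/

/-- The direct spectral problem in terms of polynomials. -/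
theorem Interlaced.isConfiguration_roots {m : ℕ} {A q : ℝ[X]} {k : ℝ} (hk : 0 < k)
    (h : Interlaced m (X * A) q) :
    IsConfiguration m k (complexify A (C k * (A - q))).roots ∧
      (X * A).roots.countP (fun x => 0 < x) =
        (complexify A (C k * (A - q))).roots.countP (fun z => 0 < z.im) ∧
      (X * A).roots.countP (fun x => x < 0) =
        (complexify A (C k * (A - q))).roots.countP (fun z => z.im < 0) := by
  obtain ⟨hRm, hRd⟩ := h.monic_complexify k
  have hA := h.monic_of_X_mul
  set B := C k * (A - q) with hB
  set Z := (complexify A B).roots with hZdef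
  have hRs : (complexify A B).Splits := IsAlgClosed.splits _
  have hZcard : Z.card = m := by rw [hZdef, ← hRs.natDegree_eq_card_roots, hRd]
  have hBroot : ∀ x, A.IsRoot x → B.eval x = -(k * q.eval x) := fun x hx => by
    have hx' : A.eval x = 0 := hx
    rw [hB, eval_mul, eval_C, eval_sub, hx']; ring
  -- A real zero of `A + i B` would be a common zero of `A` and `B`, hence of `A` and `q`, against
  -- the positivity of the residue.
  have hZim : ∀ z ∈ Z, z.im ≠ 0 := fun z hz h0 => by
    have hz' : (complexify A B).eval z = 0 := isRoot_of_mem_roots hz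
    have hzr : z = (z.re : ℂ) := Complex.ext rfl (by simpa using h0)
    rw [hzr, eval_complexify] at hz'
    have h1 : A.IsRoot z.re := by simpa using congrArg Complex.re hz'
    have h2 : B.eval z.re = 0 := by simpa using congrArg Complex.im hz'
    rw [hBroot _ h1, neg_eq_zero] at h2
    have := h.residue_pos_of_X_mul h1
    rw [(mul_eq_zero.1 h2).resolve_left hk.ne'] at this
    simp at this
  have hphase : IsPhase (zerosPhase Z) A B := isPhase_zerosPhase hZim fun x => by
    rw [prod_sub_eq_eval, ← hRs.eq_prod_roots_of_monic hRm, eval_complexify]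
  have hcross : ∀ x, A.IsRoot x → x * (A.derivative.eval x * B.eval x) < 0 := fun x hx => by
    rw [hBroot x hx]
    have := mul_pos hk (h.residue_pos_of_X_mul hx)
    linarith
  have hAs : A.Splits := splits_X_mul.1 h.splits
  have hnodup : A.roots.Nodup := nodup_roots_of_eval_derivative_ne_zero hA.ne_zero fun x hx =>
    left_ne_zero_of_mul (right_ne_zero_of_mul (hcross x hx).ne)
  have hcard : A.roots.toFinset.card = Z.countP (fun z => 0 < z.im) + Z.countP fun z => z.im < 0 := by
    rw [Multiset.toFinset_card_of_nodup hnodup, ← card_eq_countP_im_add hZim, hZcard,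
      ← hAs.natDegree_eq_card_roots, h.natDegree_of_X_mul]
  obtain ⟨hp, hm, -, hS2⟩ := hphase.card_roots_of_crossing hA.ne_zero hcross hcard
    (tendsto_zerosPhase_atTop Z) (tendsto_zerosPhase_atBot hZim) (zerosPhase_zero hZim)
  have hS0 : 0 ≤ (Z.map argModPi).sum := Multiset.sum_nonneg fun s hs => by
    obtain ⟨z, -, rfl⟩ := Multiset.mem_map.1 hs
    exact argModPi_nonneg z
  refine ⟨⟨hZcard, hZim, ?_⟩, ?_, ?_⟩
  · exact (hphase.eval_zero_pos_iff hk (zerosPhase_zero hZim) hS2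
      (by linarith [Real.pi_pos])).1 h.eval_zero_pos_of_X_mul
  · rw [countP_roots_X_mul hA.ne_zero hnodup (fun x => 0 < x) (lt_irrefl 0), hp]
  · rw [countP_roots_X_mul hA.ne_zero hnodup (fun x => x < 0) (lt_irrefl 0), hm]

/-- The inverse spectral problem in terms of polynomials. -/
theorem IsConfiguration.exists_interlaced {m : ℕ} {k : ℝ} (hk : 0 < k) {Z : Multiset ℂ}
    (hZ : IsConfiguration m k Z) : ∃ A q : ℝ[X], Interlaced m (X * A) q ∧
      complexify A (C k * (A - q)) = (Z.map fun z => X - C z).prod := by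
  obtain ⟨hZcard, hZim, hZsum⟩ := hZ
  obtain ⟨A, B, hR⟩ := exists_complexify_eq (Z.map fun z => X - C z).prod
  obtain ⟨⟨hA, hAd⟩, hBd⟩ : (A.Monic ∧ A.natDegree = m) ∧ B.degree < m := by
    rw [← complexify_degree_iff, hR]
    exact ⟨monic_multiset_prod_of_monic _ _ fun z _ => monic_X_sub_C z,
      by rw [natDegree_multiset_prod_X_sub_C_eq_card, hZcard]⟩
  have hqB : C k * (A - (A - C k⁻¹ * B)) = B := by
    rw [sub_sub_cancel, ← mul_assoc, ← C_mul, mul_inv_cancel₀ hk.ne', C_1, one_mul]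
  -- The only solution of `B = k (A - q)`; it is monic of the same degree as `A` because `deg B <
  -- m`.
  set q := A - C k⁻¹ * B with hq
  have hphase : IsPhase (zerosPhase Z) A B := isPhase_zerosPhase hZim fun x => by
    rw [prod_sub_eq_eval, ← hR, eval_complexify]
  have hS0 : 0 ≤ (Z.map argModPi).sum := Multiset.sum_nonneg fun s hs => by
    obtain ⟨z, -, rfl⟩ := Multiset.mem_map.1 hs
    exact argModPi_nonneg z
  have hS1 : -(Real.pi / 2) < (Z.map argModPi).sum := by linarith [Real.pi_pos]
  have hS2 : (Z.map argModPi).sum < Real.pi / 2 := hZsum.trans (Real.arctan_lt_pi_div_two k)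
  obtain ⟨hAs, hcross⟩ := hphase.splits_and_crossing hA.ne_zero
    (by rw [hAd, ← hZcard, card_eq_countP_im_add hZim])
    (tendsto_zerosPhase_atTop Z) (tendsto_zerosPhase_atBot hZim) (zerosPhase_zero hZim) hS2 hS1
  have hlt : (C k⁻¹ * B).degree < A.degree := by
    rwa [degree_C_mul (inv_ne_zero hk.ne'), degree_eq_natDegree hA.ne_zero, hAd]
  refine ⟨A, q, Interlaced.of_X_mul hA hAd (hA.sub_of_left hlt) ?_ hAs (fun x hx => ?_) ?_, ?_⟩
  · rw [← hAd]; exact natDegree_eq_of_degree_eq (degree_sub_eq_left_of_degree_lt hlt)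
  · have hx' : A.eval x = 0 := hx
    have e : q.eval x = -(k⁻¹ * B.eval x) := by
      rw [hq, eval_sub, eval_mul, eval_C, hx', zero_sub]
    rw [e]
    have := mul_neg_of_pos_of_neg (inv_pos.2 hk) (hcross x hx)
    linarith
  · rw [← hqB] at hphase
    exact (hphase.eval_zero_pos_iff hk (zerosPhase_zero hZim) hS2 hS1).2 hZsum
  · rw [hqB, hR]

/-! ### Return to matrices and the main theorem. -/

theorem charpoly_eq_X_mul_of_det_eq_zero {n : ℕ} {J : Matrix (Fin n) (Fin n) ℝ} (h : J.det = 0) :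
    ∃ A : ℝ[X], J.charpoly = X * A := by
  have : X ∣ J.charpoly := by
    rw [X_dvd_iff]
    rw [Matrix.det_eq_sign_charpoly_coeff] at h
    exact (mul_eq_zero.1 h).resolve_left (pow_ne_zero _ (neg_ne_zero.2 one_ne_zero))
  exact this

theorem det_eq_zero_of_charpoly_eq {n : ℕ} {J : Matrix (Fin n) (Fin n) ℝ} {A : ℝ[X]}
    (h : J.charpoly = X * A) : J.det = 0 := by
  rw [Matrix.det_eq_sign_charpoly_coeff, h]
  simp

theorem corollary5p2 (m : ℕ) (k : ℝ) (hk : 0 < k) :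
    -- direct spectral problem, and the half-plane counts
    (∀ J : Matrix (Fin (m + 1)) (Fin (m + 1)) ℝ, IsJacobi J → J.det = 0 →
      (eigenvalueMultiset (multPerturb J k)).count 0 = 1 ∧
      IsConfiguration m k ((eigenvalueMultiset (multPerturb J k)).erase 0) ∧
      (eigenvalueMultiset J).countP (fun x => 0 < x) =
        (eigenvalueMultiset (multPerturb J k)).countP (fun z => 0 < z.im) ∧
      (eigenvalueMultiset J).countP (fun x => x < 0) =
        (eigenvalueMultiset (multPerturb J k)).countP (fun z => z.im < 0)) ∧
    -- inverse spectral problem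
    (∀ Z : Multiset ℂ, IsConfiguration m k Z →
      ∃! J : Matrix (Fin (m + 1)) (Fin (m + 1)) ℝ,
        IsJacobi J ∧ J.det = 0 ∧ eigenvalueMultiset (multPerturb J k) = 0 ::ₘ Z) := by
  have heig : ∀ (J : Matrix (Fin (m + 1)) (Fin (m + 1)) ℝ), IsJacobi J → ∀ A : ℝ[X],
      J.charpoly = X * A → Interlaced m (X * A) (minorCharpoly J) ∧
        eigenvalueMultiset (multPerturb J k) =
          0 ::ₘ (complexify A (C k * (A - minorCharpoly J))).roots := fun J hJ A hA => by
    have hI : Interlaced m (X * A) (minorCharpoly J) := hA ▸ hJ.interlaced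
    refine ⟨hI, ?_⟩
    rw [eigenvalueMultiset, charpoly_multPerturb, hA, complexify_mul_X,
      roots_X_mul_complexify (hI.monic_complexify k).1.ne_zero]
  constructor
  · intro J hJ hdet
    obtain ⟨A, hA⟩ := charpoly_eq_X_mul_of_det_eq_zero hdet
    obtain ⟨hI, he⟩ := heig J hJ A hA
    obtain ⟨hconf, hp, hm⟩ := hI.isConfiguration_roots hk
    have heJ : eigenvalueMultiset J = (X * A).roots := by rw [eigenvalueMultiset, hA]
    rw [he, heJ]
    refine ⟨?_, ?_, ?_, ?_⟩
    · rw [Multiset.count_cons_self, Multiset.count_eq_zero.2 fun h0 => hconf.2.1 0 h0 rfl]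
    · rwa [Multiset.erase_cons_head]
    · rw [hp, Multiset.countP_cons_of_neg _ (by simp)]
    · rw [hm, Multiset.countP_cons_of_neg _ (by simp)]
  · intro Z hZ
    obtain ⟨A, q, hI, hR⟩ := hZ.exists_interlaced hk
    obtain ⟨J, hJ, hJp, hJq⟩ := IsJacobi.exists_of_interlaced hI
    refine ⟨J, ⟨hJ, det_eq_zero_of_charpoly_eq hJp, ?_⟩, ?_⟩
    · rw [(heig J hJ A hJp).2, hJq, hR, roots_multiset_prod_X_sub_C]
    · rintro J' ⟨hJ', hdet', he'⟩
      obtain ⟨A', hA'⟩ := charpoly_eq_X_mul_of_det_eq_zero hdet'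
      obtain ⟨hI', he⟩ := heig J' hJ' A' hA'
      rw [he, Multiset.cons_inj_right] at he'
      -- Equal spectra give equal monic polynomials `R`. Their real and imaginary parts recover `A`
      -- and, since `k ≠ 0`, the minor polynomial, and these determine the matrix.
      have hR' : complexify A' (C k * (A' - minorCharpoly J')) = complexify A (C k * (A - q)) := by
        rw [hR, ← he']
        exact (IsAlgClosed.splits _).eq_prod_roots_of_monic (hI'.monic_complexify k).1
      obtain ⟨h1, h2⟩ := complexify_injective hR'
      have h3 := mul_left_cancel₀ (C_ne_zero.2 hk.ne') h2
      rw [h1, sub_right_inj] at h3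
      exact hJ'.eq_of_charpoly_eq hJ (by rw [hA', hJp, h1]) (by rw [h3, hJq])
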